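/- All Banach spaces are complex. Let $U,X,Y$ be Banach spaces. \textbf{System nodes.} Let $A:\mathrm D(A)\subset X\to X$ be the generator of a strongly continuous semigroup $\mathbb T=(\mathbb T(t))_{t\ge 0}$ on $X$ with growth bound $\omega(\mathbb T)\in[-\infty,\infty)$, let $\mathbb C_{\omega(\mathbb T)}=\{s\in\mathbb C:\operatorname{Re}s>\omega(\mathbb T)\}$ and $R(s,A)=(s-A)^{-1}$ for $s\in\rho(A)$. Fix $\beta\in\rho(A)$. Let $X_1$ be $\mathrm D(A)$ with the norm $\|(\beta-A)x\|_X$, and let $X_{-1}\supset X$ be the completion of $X$ for the norm $\|R(\beta,A)x\|_X$ (up to equivalence of norms these do not depend on $\beta$). The operators $\mathbb T(t)$, $R(s,A)$ and $A$ extend uniquely to bounded operators $\mathbb T_{-1}(t):X_{-1}\to X_{-1}$, $R(s,A):X_{-1}\to X$ and $A:X\to X_{-1}$. A \emph{system node} $\Sigma(A,B,C,\mathbf G)$ on $(U,X,Y)$ consists of such an $A$, of bounded operators $B:U\to X_{-1}$ and $C:X_1\to Y$, and of an analytic function $\mathbf G:\mathbb C_{\omega(\mathbb T)}\to\mathcal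 L(U,Y)$ with $$\mathbf G(s)-\mathbf G(r)=C\,[R(s,A)-R(r,A)]\,B\qquad (s,r\in\mathbb C_{\omega(\mathbb T)}).$$ Its combined observation/feedthrough operator $C\&D$ has domain $\{(x,u)\in X\times U: Ax+Bu\in X\}$ and is given by $C\&D\,(x,u)=C[x-R(s,A)Bu]+\mathbf G(s)u$, which does not depend on $s\in\mathbb C_{\omega(\mathbb T)}$. \textbf{Generalised solutions.} A generalised distributional solution is a triple $(u,x,y)$ with $u\in L^1_{\mathrm{loc}}([0,\infty),U)$, $x\in C([0,\infty),X_{-1})$ given by $$x(t)=\mathbb T(t)x_0+\int_0^t\mathbb T_{-1}(t-r)Bu(r)\,dr\qquad(t\ge 0)$$ for some $x_0\in X$, and $y$ the $Y$-valued distribution on $[0,\infty)$ $$y=\frac{d^2}{dt^2}\Big(C\&D\int_0^t(t-r)\begin{bmatrix}x(r)\\u(r)\end{bmatrix}dr\Big),$$ that is, $\langle y,\varphi\rangle=\int_0^\infty\varphi''(t)\;C\&D\int_0^t(t-r)\begin{bmatrix}x(r)\\u(r)\end{bmatrix}dr\,dt$ for all $\varphi\in C_c^\infty([0,\infty))$.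 \textbf{$L^1$-LILO stability.} The system node is \emph{$L^1$-LILO stable} if there is $c>0$ such that for every generalised distributional solution $(u,x,y)$ with $x(0)=0$ one has $y\in L^1_{\mathrm{loc}}([0,\infty),Y)$ and $\|y\|_{L^1([0,t],Y)}\le c\,\|u\|_{L^1([0,t],U)}$ for all $t>0$. \textbf{Admissibility.} $C$ is \emph{infinite-time $L^1$-observation-admissible} if there is $c>0$ such that $\|C\,\mathbb T(\cdot)x\|_{L^1([0,t],Y)}\le c\,\|x\|_X$ for all $t>0$ and all $x\in\mathrm D(A)$. \textbf{Corollary.} Let $\Sigma(A,B,C,\mathbf G)$ be a system node with $0\in\rho(A)$, with $B\in\mathcal L(U,X)$ (i.e. $B$ takes values in $X$ and is bounded as an operator from $U$ to $X$), and with $C$ infinite-time $L^1$-observation-admissible. Then $\Sigma(A,B,C,\mathbf G)$ is $L^1$-LILO stable. -/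

import Mathlib

open Set Filter Topology MeasureTheory
open scoped NNReal ENNReal

noncomputable section

namespace LinSys

/-! ### Strongly continuous semigroups and their generators -/

section Semigroup

variable {X : Type*} [NormedAddCommGroup X] [NormedSpace ℂ X]

/-- A strongly continuous semigroup `(T t)_{t ≥ 0}` of bounded operators on `X`. -/
structure C0Semigroup (X : Type*) [NormedAddCommGroup X] [NormedSpace ℂ X] where
  T : ℝ≥0 → X →L[ℂ] X
  map_zero : T 0 = ContinuousLinearMap.id ℂ X
  map_add : ∀ s t, T (s + t) = (T s).comp (T t)
  continuous_orbit : ∀ x, Continuous fun t => T t x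

/-- The growth bound: the infimum of all real `ω` such that `‖T t‖ ≤ M e^{ω t}` for all `t ≥ 0`,
with some constant `M`.  It may be `-∞`. -/
def C0Semigroup.growthBound (S : C0Semigroup X) : EReal :=
  sInf {w : EReal | ∃ ω : ℝ, w = (ω : EReal) ∧
    ∃ M : ℝ, ∀ t : ℝ≥0, ‖S.T t‖ ≤ M * Real.exp (ω * t)}

/-- The open right half-plane of all `s` with real part larger than the growth bound. -/
def C0Semigroup.halfPlane (S : C0Semigroup X) : Set ℂ :=
  {s | S.growthBound < (s.re : EReal)}

/-- The unbounded operator `A` is the generator of `S`: one has `x ∈ D(A)` and `A x = z` if and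
only if `(T h x - x) / h → z` as `h ↓ 0`. -/
def IsGenerator (A : X →ₗ.[ℂ] X) (S : C0Semigroup X) : Prop :=
  ∀ x z : X, (x, z) ∈ A.graph ↔
    Tendsto (fun h : ℝ≥0 => (h : ℝ)⁻¹ • (S.T h x - x)) (𝓝[>] 0) (𝓝 z)

/-- `R` is a bounded inverse of `s - A : D(A) → X`. -/
def IsResolvent (A : X →ₗ.[ℂ] X) (s : ℂ) (R : X →L[ℂ] X) : Prop :=
  (∀ x : X, ∃ h : R x ∈ A.domain, s • R x - A ⟨R x, h⟩ = x) ∧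
    ∀ x : A.domain, R (s • (x : X) - A x) = x

/-- The resolvent set `ρ(A)`. -/
def resolventSet (A : X →ₗ.[ℂ] X) : Set ℂ := {s | ∃ R : X →L[ℂ] X, IsResolvent A s R}

/-- The resolvent operator `R(s, A) = (s - A)⁻¹` for `s ∈ ρ(A)`. -/
def res (A : X →ₗ.[ℂ] X) (s : resolventSet A) : X →L[ℂ] X := s.2.choose

theorem res_spec (A : X →ₗ.[ℂ] X) (s : resolventSet A) : IsResolvent A s (res A s) :=
  s.2.choose_spec

theorem res_mem (A : X →ₗ.[ℂ] X) (s : resolventSet A) (x : X) : res A s x ∈ A.domain :=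
  ((res_spec A s).1 x).1

theorem res_right (A : X →ₗ.[ℂ] X) (s : resolventSet A) (x : X) :
    (s : ℂ) • res A s x - A ⟨res A s x, res_mem A s x⟩ = x :=
  ((res_spec A s).1 x).2

theorem res_left (A : X →ₗ.[ℂ] X) (s : resolventSet A) (x : A.domain) :
    res A s ((s : ℂ) • (x : X) - A x) = x :=
  (res_spec A s).2 x

theorem res_injective (A : X →ₗ.[ℂ] X) (s : resolventSet A) :
    Function.Injective (res A s) := by
  intro x y h
  rw [← res_right A s x, ← res_right A s y]
  congr 1
  · rw [h]
  · congr 1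
    exact Subtype.ext h

/-- The resolvent identity. -/
theorem res_sub_res (A : X →ₗ.[ℂ] X) (s r : resolventSet A) (x : X) :
    res A s x - res A r x = ((r : ℂ) - s) • res A s (res A r x) := by
  have h1 := res_left A s ⟨res A r x, res_mem A r x⟩
  have h2 := res_right A r x
  have h3 : (s : ℂ) • res A r x - A ⟨res A r x, res_mem A r x⟩
      = x - ((r : ℂ) - s) • res A r x := by
    rw [sub_smul]
    nth_rewrite 4 [← h2]
    abel
  simp only [h3, map_sub, map_smul] at h1
  rw [sub_eq_iff_eq_add'] at h1
  rw [h1, add_sub_cancel_right]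

theorem generator_graph_map {A : X →ₗ.[ℂ] X} {S : C0Semigroup X} (hA : IsGenerator A S)
    (t : ℝ≥0) {x z : X} (h : (x, z) ∈ A.graph) : (S.T t x, S.T t z) ∈ A.graph := by
  rw [hA] at h ⊢
  have := ((S.T t).continuous.tendsto z).comp h
  refine this.congr fun r => ?_
  have e : S.T r (S.T t x) = S.T t (S.T r x) := by
    have h1 := S.map_add r t
    rw [add_comm, S.map_add] at h1
    exact (DFunLike.congr_fun h1 x).symm
  simp only [Function.comp_apply, e]
  rw [← map_sub, ContinuousLinearMap.map_smul_of_tower]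

theorem generator_mem {A : X →ₗ.[ℂ] X} {S : C0Semigroup X} (hA : IsGenerator A S)
    (t : ℝ≥0) (x : A.domain) : S.T t x ∈ A.domain := by
  have := generator_graph_map hA t (A.mem_graph x)
  rw [LinearPMap.mem_graph_iff] at this
  obtain ⟨y, hy, -⟩ := this
  simp only at hy
  exact hy ▸ y.2

/-- The semigroup commutes with the resolvents of its generator. -/
theorem res_comm {A : X →ₗ.[ℂ] X} {S : C0Semigroup X} (hA : IsGenerator A S)
    (s : resolventSet A) (t : ℝ≥0) (x : X) : res A s (S.T t x) = S.T t (res A s x) := by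
  have h := generator_graph_map hA t (A.mem_graph ⟨res A s x, res_mem A s x⟩)
  rw [LinearPMap.mem_graph_iff] at h
  obtain ⟨y, hy1, hy2⟩ := h
  have h1 := res_left A s y
  simp only at hy1 hy2
  rw [hy2, hy1, ← map_smul, ← map_sub, res_right] at h1
  exact h1

end Semigroup

/-! ### The spaces `X₁` and `X₋₁` -/

section Spaces

variable {X : Type*} [NormedAddCommGroup X] [NormedSpace ℂ X]

/-- The space `X₁`: the domain `D(A)`, normed by `‖x‖ = ‖(β - A) x‖`. -/
def XOne (A : X →ₗ.[ℂ] X) (_β : resolventSet A) : Type _ := A.domain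

/-- The space `X` with the norm `‖x‖ = ‖R(β, A) x‖`. -/
def XPre (A : X →ₗ.[ℂ] X) (_β : resolventSet A) : Type _ := X

variable (A : X →ₗ.[ℂ] X) (β : resolventSet A)

instance : AddCommGroup (XOne A β) := inferInstanceAs (AddCommGroup A.domain)
instance : Module ℂ (XOne A β) := inferInstanceAs (Module ℂ A.domain)
instance : AddCommGroup (XPre A β) := inferInstanceAs (AddCommGroup X)
instance : Module ℂ (XPre A β) := inferInstanceAs (Module ℂ X)

/-- The inclusion of `X₁` into `X`. -/
def XOne.incl : XOne A β →ₗ[ℂ] X := A.domain.subtype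

/-- An element of `D(A)`, seen in `X₁`. -/
def XOne.mk (x : X) (hx : x ∈ A.domain) : XOne A β := (⟨x, hx⟩ : A.domain)

theorem XOne.incl_mem (x : XOne A β) : XOne.incl A β x ∈ A.domain :=
  Subtype.property (p := fun y => y ∈ A.domain) x

/-- The map `β - A : X₁ → X`. -/
def XOne.shift : XOne A β →ₗ[ℂ] X := (β : ℂ) • A.domain.subtype - A.toFun

/-- The map `R(β, A)` on `X`. -/
def XPre.shift : XPre A β →ₗ[ℂ] X := (res A β).toLinearMap

theorem XOne.shift_injective : Function.Injective (XOne.shift A β) := by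
  intro x y h
  have hx := res_left A β x
  have hy := res_left A β y
  refine Subtype.ext ?_
  rw [← hx, ← hy]
  exact congrArg (res A β) h

instance : NormedAddCommGroup (XOne A β) :=
  NormedAddCommGroup.induced (XOne A β) X (XOne.shift A β) (XOne.shift_injective A β)
instance : NormedSpace ℂ (XOne A β) := NormedSpace.induced ℂ (XOne A β) X (XOne.shift A β)
instance : NormedAddCommGroup (XPre A β) :=
  NormedAddCommGroup.induced (XPre A β) X (XPre.shift A β) (res_injective A β)
instance : NormedSpace ℂ (XPre A β) := NormedSpace.induced ℂ (XPre A β) X (XPre.shift A β)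

/-- The extrapolation space `X₋₁`: the completion of `X` for the norm `‖R(β, A) x‖`. -/
abbrev XMinus : Type _ := UniformSpace.Completion (XPre A β)

/-- The identity of `X`, into `X` with the weaker norm. -/
def toPre : X →ₗ[ℂ] XPre A β := LinearMap.id

/-- The canonical embedding of `X` into `X₋₁`. -/
def emb : X →ₗ[ℂ] XMinus A β :=
  (UniformSpace.Completion.toComplL (𝕜 := ℂ) (E := XPre A β)).toLinearMap ∘ₗ toPre A β

theorem XOne.norm_eq (x : XOne A β) : ‖x‖ = ‖XOne.shift A β x‖ := rfl

theorem norm_emb (x : X) : ‖emb A β x‖ = ‖res A β x‖ :=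
  (UniformSpace.Completion.norm_coe (toPre A β x)).trans rfl

theorem emb_injective : Function.Injective (emb A β) := by
  rw [injective_iff_map_eq_zero]
  intro x hx
  have h := norm_emb A β x
  rw [hx, norm_zero, eq_comm, norm_eq_zero] at h
  exact res_injective A β (by rw [h, map_zero])

theorem emb_denseRange : DenseRange (emb A β) :=
  UniformSpace.Completion.denseRange_coe (α := XPre A β)

/-- The continuous extension of `R(s, A)` to a bounded operator from `X₋₁` to `X`. -/
def resExt [CompleteSpace X] (s : resolventSet A) : XMinus A β →L[ℂ] X :=
  LinearMap.extendOfNorm (res A s).toLinearMap (emb A β)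

theorem resExt_emb [CompleteSpace X] (s : resolventSet A) (x : X) :
    resExt A β s (emb A β x) = res A s x := by
  refine LinearMap.extendOfNorm_eq (emb_denseRange A β)
    ⟨1 + ‖((β : ℂ) - s) • res A s‖, fun x => ?_⟩ x
  rw [norm_emb]
  have h : res A s x = res A β x + (((β : ℂ) - s) • res A s) (res A β x) := by
    have := res_sub_res A s β x
    rw [smul_apply, ← this]
    abel
  calc ‖res A s x‖ = ‖res A β x + (((β : ℂ) - s) • res A s) (res A β x)‖ := by rw [← h]
    _ ≤ ‖res A β x‖ + ‖((β : ℂ) - s) • res A s‖ * ‖res A β x‖ :=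
      (norm_add_le _ _).trans (by gcongr; exact ContinuousLinearMap.le_opNorm _ _)
    _ = _ := by ring

/-- The resolvent identity on `X₋₁`. -/
theorem resExt_sub_resExt [CompleteSpace X] (s r : resolventSet A) (ξ : XMinus A β) :
    resExt A β s ξ - resExt A β r ξ = ((r : ℂ) - s) • res A s (resExt A β r ξ) := by
  refine (emb_denseRange A β).induction_on ξ
    (isClosed_eq (by fun_prop) (by fun_prop)) fun x => ?_
  rw [resExt_emb, resExt_emb]
  exact res_sub_res A s r x

theorem resExt_sub_mem [CompleteSpace X] (s r : resolventSet A) (ξ : XMinus A β) :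
    resExt A β s ξ - resExt A β r ξ ∈ A.domain := by
  rw [resExt_sub_resExt]
  exact A.domain.smul_mem _ (res_mem A s _)

/-- The continuous extension `T₋₁(t)` of `T t` to `X₋₁`. -/
def semigroupExt (S : C0Semigroup X) (t : ℝ≥0) : XMinus A β →L[ℂ] XMinus A β :=
  LinearMap.extendOfNorm (emb A β ∘ₗ (S.T t).toLinearMap) (emb A β)

theorem semigroupExt_emb {S : C0Semigroup X} (hA : IsGenerator A S) (t : ℝ≥0) (x : X) :
    semigroupExt A β S t (emb A β x) = emb A β (S.T t x) := by
  refine LinearMap.extendOfNorm_eq (emb_denseRange A β) ⟨‖S.T t‖, fun x => ?_⟩ x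
  rw [norm_emb, LinearMap.comp_apply, norm_emb]
  refine le_trans (le_of_eq ?_) ((S.T t).le_opNorm (res A β x))
  exact congrArg norm (res_comm hA β t x)

/-- The graph of `A₋₁ : X ⊂ X₋₁ → X₋₁`, the extension of `A` to `X`: it is the closure of the
graph of `A` in `X₋₁ × X₋₁`. -/
def extGraph : Submodule ℂ (XMinus A β × XMinus A β) :=
  (A.graph.map ((emb A β).prodMap (emb A β))).topologicalClosure

/-- If `A₋₁ x = w`, then `x = R(s, A) (s x - w)`. -/
theorem resExt_of_mem_extGraph [CompleteSpace X] (s : resolventSet A) {x : X} {w : XMinus A β}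
    (h : (emb A β x, w) ∈ extGraph A β) :
    resExt A β s ((s : ℂ) • emb A β x - w) = x := by
  have hcont : Continuous (emb A β) :=
    AddMonoidHomClass.continuous_of_bound (emb A β) ‖res A β‖ fun x => by
      rw [norm_emb]; exact (res A β).le_opNorm x
  have hR : Continuous (resExt A β s) := (resExt A β s).continuous
  have hf : Continuous fun p : XMinus A β × XMinus A β => (s : ℂ) • p.1 - p.2 :=
    (continuous_fst.const_smul (s : ℂ)).sub continuous_snd
  have hclosed : IsClosed {p : XMinus A β × XMinus A β |
      emb A β (resExt A β s ((s : ℂ) • p.1 - p.2)) = p.1} :=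
    isClosed_eq (hcont.comp (hR.comp hf)) continuous_fst
  have hsub : (A.graph.map ((emb A β).prodMap (emb A β)) : Set (XMinus A β × XMinus A β)) ⊆
      {p | emb A β (resExt A β s ((s : ℂ) • p.1 - p.2)) = p.1} := by
    rintro _ ⟨⟨x, z⟩, hq, rfl⟩
    obtain ⟨y, hy1, hy2⟩ := (LinearPMap.mem_graph_iff A).1 hq
    simp only at hy1 hy2
    subst hy1 hy2
    change emb A β (resExt A β s ((s : ℂ) • emb A β y - emb A β (A y))) = emb A β y
    rw [← map_smul, ← map_sub, resExt_emb, res_left]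
  have key := closure_minimal hsub hclosed h
  exact emb_injective A β key

end Spaces

/-! ### System nodes -/

/-- A system node `Σ(A, B, C, G)` on `(U, X, Y)`.  The point `β ∈ ρ(A)` is the one used to norm
`X₁` and `X₋₁`; another choice gives the same spaces with equivalent norms.  Only the values of
`G` on the half-plane to the right of the growth bound are relevant (this half-plane is always
contained in `ρ(A)`). -/
structure SystemNode (U X Y : Type*) [NormedAddCommGroup U] [NormedSpace ℂ U]
    [NormedAddCommGroup X] [NormedSpace ℂ X] [CompleteSpace X]
    [NormedAddCommGroup Y] [NormedSpace ℂ Y] where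
  A : X →ₗ.[ℂ] X
  S : C0Semigroup X
  isGenerator : IsGenerator A S
  β : resolventSet A
  B : U →L[ℂ] XMinus A β
  C : XOne A β →L[ℂ] Y
  G : ℂ → U →L[ℂ] Y
  analytic : AnalyticOnNhd ℂ G S.halfPlane
  transfer : ∀ s r : resolventSet A, (s : ℂ) ∈ S.halfPlane → (r : ℂ) ∈ S.halfPlane → ∀ u : U,
    G s u - G r u =
      C (XOne.mk A β (resExt A β s (B u) - resExt A β r (B u)) (resExt_sub_mem A β s r (B u)))

namespace SystemNode

variable {U X Y : Type*} [NormedAddCommGroup U] [NormedSpace ℂ U]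
  [NormedAddCommGroup X] [NormedSpace ℂ X] [CompleteSpace X]
  [NormedAddCommGroup Y] [NormedSpace ℂ Y]

variable (N : SystemNode U X Y)

/-- The state space embedded into `X₋₁`. -/
def ι : X →ₗ[ℂ] XMinus N.A N.β := emb N.A N.β

/-- The semigroup extended to `X₋₁`. -/
def Text (t : ℝ≥0) : XMinus N.A N.β →L[ℂ] XMinus N.A N.β := semigroupExt N.A N.β N.S t

/-- The domain of `C&D`: all `(x, u) ∈ X × U` with `A₋₁ x + B u ∈ X`. -/
def combinedDomain : Submodule ℂ (X × U) where
  carrier := {p | ∃ z : X, (N.ι p.1, N.ι z - N.B p.2) ∈ extGraph N.A N.β}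
  zero_mem' := ⟨0, by
    rw [Prod.fst_zero, Prod.snd_zero, map_zero, map_zero, sub_zero]
    exact (extGraph N.A N.β).zero_mem⟩
  add_mem' := by
    rintro p q ⟨z, hz⟩ ⟨w, hw⟩
    refine ⟨z + w, ?_⟩
    have := (extGraph N.A N.β).add_mem hz hw
    rw [Prod.mk_add_mk] at this
    simpa only [Prod.fst_add, Prod.snd_add, map_add, add_sub_add_comm] using this
  smul_mem' := by
    rintro c p ⟨z, hz⟩
    refine ⟨c • z, ?_⟩
    have := (extGraph N.A N.β).smul_mem c hz
    rw [Prod.smul_mk] at this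
    simpa only [Prod.smul_fst, Prod.smul_snd, map_smul, smul_sub] using this

theorem combined_mem (s : resolventSet N.A) (p : N.combinedDomain) :
    p.1.1 - resExt N.A N.β s (N.B p.1.2) ∈ N.A.domain := by
  obtain ⟨⟨x, u⟩, z, hz⟩ := p
  have h := resExt_of_mem_extGraph N.A N.β s hz
  have h2 : x - resExt N.A N.β s (N.B u) = res N.A s ((s : ℂ) • x - z) := by
    rw [sub_eq_iff_eq_add, ← resExt_emb N.A N.β s, ← map_add]
    refine h.symm.trans (congrArg _ ?_)
    simp only [ι, map_sub, map_smul]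
    abel
  simp only [h2]
  exact res_mem N.A s _

/-- The combined observation/feedthrough operator
`C&D (x, u) = C (x - R(s, A) B u) + G(s) u`, with domain `{(x, u) | A x + B u ∈ X}`. -/
def combined (s : resolventSet N.A) : (X × U) →ₗ.[ℂ] Y where
  domain := N.combinedDomain
  toFun :=
    { toFun := fun p =>
        N.C (XOne.mk N.A N.β (p.1.1 - resExt N.A N.β s (N.B p.1.2)) (N.combined_mem s p))
          + N.G s p.1.2
      map_add' := by
        intro p q
        have h : XOne.mk N.A N.β _ (N.combined_mem s (p + q)) =
            XOne.mk N.A N.β _ (N.combined_mem s p) + XOne.mk N.A N.β _ (N.combined_mem s q) := by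
          refine Subtype.ext ?_
          change (p.1.1 + q.1.1) - resExt N.A N.β s (N.B (p.1.2 + q.1.2)) =
            (p.1.1 - resExt N.A N.β s (N.B p.1.2)) + (q.1.1 - resExt N.A N.β s (N.B q.1.2))
          rw [map_add, map_add]
          abel
        rw [h, map_add, Submodule.coe_add, Prod.snd_add, map_add]
        abel
      map_smul' := by
        intro c p
        have h : XOne.mk N.A N.β _ (N.combined_mem s (c • p)) =
            c • XOne.mk N.A N.β _ (N.combined_mem s p) := by
          refine Subtype.ext ?_
          change c • p.1.1 - resExt N.A N.β s (N.B (c • p.1.2)) =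
            c • (p.1.1 - resExt N.A N.β s (N.B p.1.2))
          rw [map_smul, map_smul, smul_sub]
        rw [h, map_smul, Submodule.coe_smul, Prod.smul_snd, map_smul, RingHom.id_apply, smul_add] }

/-- `D(A)` is invariant under the semigroup; this is the action of `T t` on `X₁`. -/
def Tone (t : ℝ≥0) (x : XOne N.A N.β) : XOne N.A N.β :=
  XOne.mk N.A N.β (N.S.T t (XOne.incl N.A N.β x))
    (generator_mem N.isGenerator t ⟨_, XOne.incl_mem N.A N.β x⟩)

open Classical in
/-- The function `t ↦ C&D (∫₀ᵗ (t - r) (x r, u r) dr)`, the integrals being taken in `X₋₁` and in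
`U`.  For a generalised solution the pair of integrals always belongs to the domain of `C&D`; the
value `0` is a placeholder for all other `u`, `x`. -/
def outputPrimitive (s : resolventSet N.A) (u : ℝ → U) (x : ℝ → XMinus N.A N.β) (t : ℝ) : Y :=
  if h : ∃ p : (N.combined s).domain,
      N.ι p.1.1 = ∫ r in (0 : ℝ)..t, (t - r) • x r ∧
      p.1.2 = ∫ r in (0 : ℝ)..t, (t - r) • u r
  then N.combined s h.choose else 0

/-- `(u, x, y)` is a generalised solution in the distributional sense: `u ∈ L¹_loc([0,∞), U)`,
`x ∈ C([0,∞), X₋₁)` is given by the variation of constants formula with some initial value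
`x₀ ∈ X`, and `y` is the distribution on `[0,∞)` which is the second derivative of
`t ↦ C&D (∫₀ᵗ (t - r) (x r, u r) dr)`.

A distribution on `[0,∞)` is one on `ℝ` that acts on a test function `φ` through the restriction
of `φ` to `[0,∞)`. -/
structure IsGeneralizedSolution (u : ℝ → U) (x : ℝ → XMinus N.A N.β)
    (y : Distribution (⊤ : TopologicalSpace.Opens ℝ) Y ⊤) : Prop where
  locallyIntegrable : LocallyIntegrableOn u (Ici 0)
  continuousOn : ContinuousOn x (Ici 0)
  state : ∃ x₀ : X, ∀ t : ℝ, 0 ≤ t →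
    x t = N.ι (N.S.T t.toNNReal x₀)
      + ∫ r in (0 : ℝ)..t, N.Text (t - r).toNNReal (N.B (u r))
  output : ∃ s : resolventSet N.A, (s : ℂ) ∈ N.S.halfPlane ∧
    ∀ φ : TestFunction (⊤ : TopologicalSpace.Opens ℝ) ℝ ⊤,
      y φ = ∫ t in Ici (0 : ℝ), iteratedDeriv 2 φ t • N.outputPrimitive s u x t

/-- The distribution `y` on `[0,∞)` is given by the function `f ∈ L¹_loc([0,∞), Y)`. -/
def IsRepresentedBy (y : Distribution (⊤ : TopologicalSpace.Opens ℝ) Y ⊤) (f : ℝ → Y) : Prop :=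
  LocallyIntegrableOn f (Ici 0) ∧
    ∀ φ : TestFunction (⊤ : TopologicalSpace.Opens ℝ) ℝ ⊤,
      y φ = ∫ t in Ici (0 : ℝ), φ t • f t

/-- `L¹`-LILO stability: there is `c > 0` such that for every generalised solution `(u, x, y)`
with `x 0 = 0` the output `y` is in `L¹_loc([0,∞), Y)` and
`‖y‖_{L¹([0,t], Y)} ≤ c ‖u‖_{L¹([0,t], U)}` for all `t > 0`. -/
def IsL1LILOStable : Prop :=
  ∃ c : ℝ, 0 < c ∧ ∀ (u : ℝ → U) (x : ℝ → XMinus N.A N.β)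
    (y : Distribution (⊤ : TopologicalSpace.Opens ℝ) Y ⊤),
    N.IsGeneralizedSolution u x y → x 0 = 0 →
      ∃ f : ℝ → Y, IsRepresentedBy y f ∧
        ∀ t : ℝ, 0 < t →
          eLpNorm f 1 (volume.restrict (Icc 0 t))
            ≤ ENNReal.ofReal c * eLpNorm u 1 (volume.restrict (Icc 0 t))

/-- The input operator is bounded: `B` has values in `X` and is bounded from `U` to `X`. -/
def HasBoundedInput : Prop := ∃ B₀ : U →L[ℂ] X, ∀ u : U, N.B u = N.ι (B₀ u)

/-- `C` is infinite-time `L¹`-observation-admissible: there is `c > 0` such that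
`‖C T(·) x‖_{L¹([0,t], Y)} ≤ c ‖x‖_X` for all `t > 0` and all `x ∈ X₁`. -/
def IsInfTimeL1ObsAdmissible : Prop :=
  ∃ c : ℝ, 0 < c ∧ ∀ t : ℝ, 0 < t → ∀ x : XOne N.A N.β,
    eLpNorm (fun r : ℝ => N.C (N.Tone r.toNNReal x)) 1 (volume.restrict (Icc 0 t))
      ≤ ENNReal.ofReal (c * ‖XOne.incl N.A N.β x‖)

end SystemNode

end LinSys

end

/-! ### Strongly continuous operator families -/

/-! Formally the output is `C x + D u`, with `x` the mild solution in `X` driven by `w = B₀ u`.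
Boundedness of `B₀` provides a feedthrough `D` with `G(s) = D + C R(s, A) B₀`
(`exists_feedthrough`), so only the observation part needs work, and there `C` is unbounded.

Admissibility says that `x ↦ C T(·) x`, defined on `D(A)`, is bounded for the norm of `X` with
values in `L¹`. By density it extends to all of `X`, and composing it with the delay by `r` gives a
bounded strongly continuous family `K r` (`exists_delayed_output_map`). The output is the Bochner
integral `f = ∫ K r (w r) dr` in `L¹(ℝ, Y)`. The triangle inequality in `L¹` bounds it by `c ‖w‖`;
since `K r` vanishes before time `r`, the same constant works on every `[0, t]`.

It remains to see that `f` is the right distribution. The functional `f ↦ ∫₀ᵗ (t - σ) f σ dσ` is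
continuous on `L¹`, so it passes through the Bochner integral. The double primitive of the state
lies in `D(A)`, as `R(β, A)` applied to a convolution with a bounded family; hence `C` acts on it
through the bounded operator `C R(β, A)`. The two sides agree on `D(A)`, hence everywhere
(`weightedIntegral_delayed_output`). Taylor's formula for the test function then undoes the double
primitive (`integral_iteratedDeriv_two_smul`). -/

section StrongFamilies

variable {𝕜 X E : Type*} [NontriviallyNormedField 𝕜]
  [NormedAddCommGroup X] [NormedSpace 𝕜 X] [CompleteSpace X]
  [NormedAddCommGroup E] [NormedSpace 𝕜 E]

/-- A strongly continuous operator family is bounded on compact sets. -/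
theorem exists_norm_le_of_strongly_continuous {α : Type*} [TopologicalSpace α]
    {K : α → X →L[𝕜] E} (hK : ∀ x, Continuous fun t => K t x) {s : Set α} (hs : IsCompact s) :
    ∃ M, ∀ t ∈ s, ‖K t‖ ≤ M := by
  obtain ⟨M, hM⟩ := banach_steinhaus (g := fun t : s => K t) fun x => by
    obtain ⟨C, hC⟩ := hs.exists_bound_of_continuousOn (hK x).continuousOn
    exact ⟨C, fun t => hC t t.2⟩
  exact ⟨M, fun t ht => hM ⟨t, ht⟩⟩

/-- A strongly continuous operator family is jointly continuous. -/
theorem continuous_apply_of_strongly_continuous {α : Type*} [TopologicalSpace α]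
    [WeaklyLocallyCompactSpace α] {K : α → X →L[𝕜] E} (hK : ∀ x, Continuous fun t => K t x) :
    Continuous fun p : α × X => K p.1 p.2 := by
  rw [continuous_iff_continuousAt]
  rintro ⟨t₀, x₀⟩
  obtain ⟨s, hs, hst⟩ := exists_compact_mem_nhds t₀
  obtain ⟨M, hM⟩ := exists_norm_le_of_strongly_continuous hK hs
  have h1 : Tendsto (fun p : α × X => M * ‖p.2 - x₀‖ + ‖K p.1 x₀ - K t₀ x₀‖) (𝓝 (t₀, x₀))
      (𝓝 0) := by
    have : Continuous fun p : α × X => M * ‖p.2 - x₀‖ + ‖K p.1 x₀ - K t₀ x₀‖ := by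
      have := (hK x₀).comp (continuous_fst : Continuous (Prod.fst : α × X → α))
      fun_prop
    simpa using this.tendsto (t₀, x₀)
  refine tendsto_iff_norm_sub_tendsto_zero.2 (squeeze_zero' (.of_forall fun _ => norm_nonneg _)
    ?_ h1)
  filter_upwards [continuous_fst.continuousAt.preimage_mem_nhds hst] with p hp
  -- The first term is controlled by the local uniform bound, the second by strong continuity at the
  -- fixed vector `x₀`.
  have e : K p.1 p.2 - K t₀ x₀ = K p.1 (p.2 - x₀) + (K p.1 x₀ - K t₀ x₀) := by
    rw [map_sub]; abel
  rw [e]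
  refine (norm_add_le _ _).trans ?_
  gcongr
  exact (K p.1).le_of_opNorm_le (hM _ hp) _

/-- A strongly continuous family, applied pointwise to an integrable function on a set contained
in a compact set, is integrable. -/
theorem integrableOn_strong_family_apply {α : Type*} [TopologicalSpace α]
    [WeaklyLocallyCompactSpace α] [MeasurableSpace α] [OpensMeasurableSpace α]
    [TopologicalSpace.PseudoMetrizableSpace α] [SecondCountableTopology α]
    {K : α → X →L[𝕜] E} (hK : ∀ x, Continuous fun t => K t x) {μ : Measure α} {s k : Set α}
    (hs : MeasurableSet s) (hk : IsCompact k) (hsk : s ⊆ k) {w : α → X}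
    (hw : IntegrableOn w s μ) : IntegrableOn (fun r => K r (w r)) s μ := by
  obtain ⟨M, hM⟩ := exists_norm_le_of_strongly_continuous hK hk
  refine (hw.norm.const_mul M).mono' ?_ ?_
  · exact (continuous_apply_of_strongly_continuous hK).comp_aestronglyMeasurable
      (continuous_id.aestronglyMeasurable.prodMk hw.aestronglyMeasurable)
  · filter_upwards [ae_restrict_mem hs] with r hr
    exact (K r).le_of_opNorm_le (hM _ (hsk hr)) _

theorem intervalIntegrable_strong_family_apply {K : ℝ → X →L[𝕜] E}
    (hK : ∀ x, Continuous fun t => K t x) {a b : ℝ} {w : ℝ → X}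
    (hw : IntervalIntegrable w volume a b) :
    IntervalIntegrable (fun r => K r (w r)) volume a b := by
  rw [intervalIntegrable_iff] at hw ⊢
  exact integrableOn_strong_family_apply hK measurableSet_uIoc isCompact_uIcc uIoc_subset_uIcc hw

/-- Integrability over a square of a strongly continuous two-parameter family applied to an
integrable function of one of the parameters. -/
theorem integrable_prod_strong_family_apply {K : ℝ × ℝ → X →L[𝕜] E}
    (hK : ∀ x, Continuous fun p => K p x) {t : ℝ} {w : ℝ → X} (hw : IntegrableOn w (Ioc 0 t)) :
    Integrable (fun p : ℝ × ℝ => K p (w p.2))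
      ((volume.restrict (Ioc 0 t)).prod (volume.restrict (Ioc 0 t))) := by
  have h := hw.integrable.comp_snd (volume.restrict (Ioc 0 t))
  rw [Measure.prod_restrict] at h ⊢
  exact integrableOn_strong_family_apply hK (measurableSet_Ioc.prod measurableSet_Ioc)
    (isCompact_Icc.prod isCompact_Icc) (prod_mono Ioc_subset_Icc_self Ioc_subset_Icc_self) h

end StrongFamilies

/-! ### Fubini on a triangle and double primitives -/

section Triangle

variable {E : Type*} [NormedAddCommGroup E] [NormedSpace ℝ E]

/-- Fubini's theorem on the triangle `0 < ρ ≤ r ≤ t`. -/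
theorem intervalIntegral_integral_swap_triangle {F : ℝ → ℝ → E} {t : ℝ} (ht : 0 ≤ t)
    (hF : Integrable (Function.uncurry F)
      ((volume.restrict (Ioc 0 t)).prod (volume.restrict (Ioc 0 t)))) :
    ∫ r in (0 : ℝ)..t, ∫ ρ in (0 : ℝ)..r, F r ρ = ∫ ρ in (0 : ℝ)..t, ∫ r in ρ..t, F r ρ := by
  have hm : MeasurableSet {p : ℝ × ℝ | p.2 ≤ p.1} := measurableSet_le measurable_snd measurable_fst
  have h := integral_integral_swap (f := fun r ρ =>
    {p : ℝ × ℝ | p.2 ≤ p.1}.indicator (Function.uncurry F) (r, ρ)) (hF.indicator hm)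
  rw [intervalIntegral.integral_of_le ht, intervalIntegral.integral_of_le ht]
  refine Eq.trans ?_ (h.trans ?_)
  · refine setIntegral_congr_fun measurableSet_Ioc fun r hr => ?_
    have e : (fun ρ => {p : ℝ × ℝ | p.2 ≤ p.1}.indicator (Function.uncurry F) (r, ρ)) =
        (Iic r).indicator (F r) := by
      ext ρ; simp [indicator, Function.uncurry]
    simp only [e]
    rw [setIntegral_indicator measurableSet_Iic, intervalIntegral.integral_of_le hr.1.le]
    congr 2
    ext ρ; simp only [mem_Ioc, mem_inter_iff, mem_Iic] at hr ⊢; grind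
  · refine setIntegral_congr_fun measurableSet_Ioc fun ρ hr => ?_
    have e : (fun r => {p : ℝ × ℝ | p.2 ≤ p.1}.indicator (Function.uncurry F) (r, ρ)) =
        (Ici ρ).indicator (fun r => F r ρ) := by
      ext r; simp [indicator, Function.uncurry]
    simp only [e]
    rw [setIntegral_indicator measurableSet_Ici, intervalIntegral.integral_of_le hr.2,
      ← integral_Icc_eq_integral_Ioc]
    congr 2
    ext r; simp only [mem_Ioc, mem_inter_iff, mem_Ici, mem_Icc] at hr ⊢; grind

/-- The double primitive of `g` is `∫₀ᵗ (t - r) g r dr`. -/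
theorem intervalIntegral_sub_smul_eq [CompleteSpace E] {g : ℝ → E} {t : ℝ} (ht : 0 ≤ t)
    (hg : IntegrableOn g (Ioc 0 t)) :
    ∫ r in (0 : ℝ)..t, (t - r) • g r = ∫ r in (0 : ℝ)..t, ∫ ρ in (0 : ℝ)..r, g ρ := by
  rw [intervalIntegral_integral_swap_triangle (F := fun _ ρ => g ρ) ht
    (hg.integrable.comp_snd (volume.restrict (Ioc 0 t)))]
  simp

end Triangle

/-! ### Primitives of operator families and convolutions -/

section Primitive

variable {X E : Type*}
  [NormedAddCommGroup X] [NormedSpace ℂ X] [CompleteSpace X]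
  [NormedAddCommGroup E] [NormedSpace ℂ E]

/-- The strong primitive `x ↦ ∫₀ᵗ K σ x dσ` of a strongly continuous family. -/
noncomputable def strongPrimitive (K : ℝ → X →L[ℂ] E) (hK : ∀ x, Continuous fun t => K t x)
    (t : ℝ) : X →L[ℂ] E where
  toFun x := ∫ σ in (0 : ℝ)..t, K σ x
  map_add' x y := by
    simp only [map_add]
    exact intervalIntegral.integral_add ((hK x).intervalIntegrable _ _)
      ((hK y).intervalIntegrable _ _)
  map_smul' c x := by
    simp only [map_smul, RingHom.id_apply]
    exact intervalIntegral.integral_smul c _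
  cont := intervalIntegral.continuous_parametric_intervalIntegral_of_continuous'
    (f := fun x σ => K σ x) ((continuous_apply_of_strongly_continuous hK).comp continuous_swap) 0 t

theorem strongPrimitive_apply (K : ℝ → X →L[ℂ] E) (hK : ∀ x, Continuous fun t => K t x)
    (t : ℝ) (x : X) : strongPrimitive K hK t x = ∫ σ in (0 : ℝ)..t, K σ x := rfl

theorem continuous_strongPrimitive (K : ℝ → X →L[ℂ] E) (hK : ∀ x, Continuous fun t => K t x)
    (x : X) : Continuous fun t => strongPrimitive K hK t x :=
  intervalIntegral.continuous_primitive (fun _ _ => (hK x).intervalIntegrable _ _) 0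

/-- The primitive of the convolution `K * w` is the convolution of the primitive of `K`
with `w`. -/
theorem integral_convolution_eq {K : ℝ → X →L[ℂ] E} (hK : ∀ x, Continuous fun t => K t x)
    {t : ℝ} (ht : 0 ≤ t) {w : ℝ → X} (hw : IntegrableOn w (Ioc 0 t)) :
    ∫ r in (0 : ℝ)..t, ∫ ρ in (0 : ℝ)..r, K (r - ρ) (w ρ) =
      ∫ ρ in (0 : ℝ)..t, strongPrimitive K hK (t - ρ) (w ρ) := by
  rw [intervalIntegral_integral_swap_triangle (F := fun r ρ => K (r - ρ) (w ρ)) ht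
    (integrable_prod_strong_family_apply (K := fun p => K (p.1 - p.2))
      (fun x => (hK x).comp (by fun_prop)) hw)]
  refine intervalIntegral.integral_congr fun ρ _ => ?_
  simp only [strongPrimitive_apply]
  rw [intervalIntegral.integral_comp_sub_right (fun σ => K σ (w ρ)), sub_self]

/-- The convolution of a strongly continuous family with a locally integrable function is
integrable on bounded intervals. -/
theorem integrableOn_convolution {K : ℝ → X →L[ℂ] E} (hK : ∀ x, Continuous fun t => K t x)
    {t : ℝ} {w : ℝ → X} (hw : IntegrableOn w (Ioc 0 t)) :
    IntegrableOn (fun r => ∫ ρ in (0 : ℝ)..r, K (r - ρ) (w ρ)) (Ioc 0 t) := by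
  have hm : MeasurableSet {p : ℝ × ℝ | p.2 ≤ p.1} := measurableSet_le measurable_snd measurable_fst
  have h := ((integrable_prod_strong_family_apply (K := fun p => K (p.1 - p.2))
    (fun x => (hK x).comp (by fun_prop)) hw).indicator hm).integral_prod_left
  refine h.congr ?_
  filter_upwards [ae_restrict_mem measurableSet_Ioc] with r hr
  have e : (fun ρ => {p : ℝ × ℝ | p.2 ≤ p.1}.indicator (fun p => K (p.1 - p.2) (w p.2)) (r, ρ)) =
      (Iic r).indicator (fun ρ => K (r - ρ) (w ρ)) := by
    ext ρ; simp [indicator]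
  rw [e, setIntegral_indicator measurableSet_Iic, intervalIntegral.integral_of_le hr.1.le]
  congr 2
  ext ρ; simp only [mem_Ioc, mem_inter_iff, mem_Iic] at hr ⊢; grind

end Primitive

/-! ### Integrals of the semigroup and their factorisation through the resolvent -/

namespace LinSys

section SemigroupCalculus

variable {X : Type*} [NormedAddCommGroup X] [NormedSpace ℂ X]

/-- The semigroup as a family indexed by the real line, constant for negative times. -/
noncomputable def C0Semigroup.flow (S : C0Semigroup X) (t : ℝ) : X →L[ℂ] X := S.T t.toNNReal

theorem C0Semigroup.continuous_flow (S : C0Semigroup X) (x : X) :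
    Continuous fun t => S.flow t x :=
  (S.continuous_orbit x).comp continuous_real_toNNReal

theorem C0Semigroup.flow_zero (S : C0Semigroup X) (x : X) : S.flow 0 x = x := by
  simp [flow, S.map_zero]

theorem C0Semigroup.flow_coe (S : C0Semigroup X) (t : ℝ≥0) : S.flow t = S.T t := by
  simp [flow]

theorem C0Semigroup.flow_add (S : C0Semigroup X) {s t : ℝ} (hs : 0 ≤ s) (ht : 0 ≤ t) (x : X) :
    S.flow (s + t) x = S.flow s (S.flow t x) := by
  simp [flow, Real.toNNReal_add hs ht, S.map_add]

theorem res_flow {A : X →ₗ.[ℂ] X} {S : C0Semigroup X} (hA : IsGenerator A S)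
    (β : resolventSet A) (t : ℝ) (x : X) : res A β (S.flow t x) = S.flow t (res A β x) :=
  res_comm hA β _ x

variable [CompleteSpace X]

/-- The integral `x ↦ ∫₀ᵗ T(σ) x dσ` of the semigroup. -/
noncomputable def C0Semigroup.integral (S : C0Semigroup X) : ℝ → X →L[ℂ] X :=
  strongPrimitive S.flow S.continuous_flow

theorem C0Semigroup.integral_apply (S : C0Semigroup X) (t : ℝ) (x : X) :
    S.integral t x = ∫ σ in (0 : ℝ)..t, S.flow σ x := rfl

theorem C0Semigroup.continuous_integral (S : C0Semigroup X) (x : X) :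
    Continuous fun t => S.integral t x :=
  continuous_strongPrimitive _ S.continuous_flow x

theorem C0Semigroup.hasDerivAt_integral (S : C0Semigroup X) (x : X) (t : ℝ) :
    HasDerivAt (fun t => S.integral t x) (S.flow t x) t :=
  intervalIntegral.integral_hasDerivAt_right ((S.continuous_flow x).intervalIntegrable _ _)
    (S.continuous_flow x).stronglyMeasurable.stronglyMeasurableAtFilter
    (S.continuous_flow x).continuousAt

/-- The semigroup law shifts the interval of integration. This turns difference quotients of the
semigroup at an integrated orbit into slopes of the primitive. -/
theorem C0Semigroup.flow_integral (S : C0Semigroup X) (x : X) {s t : ℝ} (hs : 0 ≤ s)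
    (ht : 0 ≤ t) : S.flow s (S.integral t x) = S.integral (t + s) x - S.integral s x := by
  have hi := fun a b : ℝ => (S.continuous_flow x).intervalIntegrable (μ := volume) a b
  rw [S.integral_apply, S.integral_apply, S.integral_apply,
    intervalIntegral.integral_interval_sub_left (hi _ _) (hi _ _),
    ← ContinuousLinearMap.intervalIntegral_comp_comm _ (hi _ _)]
  have : ∫ σ in (0 : ℝ)..t, S.flow s (S.flow σ x) = ∫ σ in (0 : ℝ)..t, S.flow (σ + s) x := by
    refine intervalIntegral.integral_congr fun σ hσ => ?_
    rw [uIcc_of_le ht] at hσ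
    rw [add_comm, S.flow_add hs hσ.1]
  rw [this, intervalIntegral.integral_comp_add_right (fun σ => S.flow σ x), zero_add]

theorem tendsto_coe_nhdsGT_zero : Tendsto ((↑) : ℝ≥0 → ℝ) (𝓝[>] 0) (𝓝[>] 0) := by
  refine tendsto_nhdsWithin_iff.2 ⟨?_, ?_⟩
  · exact (NNReal.continuous_coe.tendsto 0).mono_left nhdsWithin_le_nhds
  · filter_upwards [self_mem_nhdsWithin] with t ht
    exact NNReal.coe_pos.2 ht

/-- Integrals of orbits lie in the domain of the generator. -/
theorem IsGenerator.integral_mem_graph {A : X →ₗ.[ℂ] X} {S : C0Semigroup X}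
    (hA : IsGenerator A S) (x : X) {t : ℝ} (ht : 0 ≤ t) :
    (S.integral t x, S.flow t x - x) ∈ A.graph := by
  rw [hA]
  -- The difference quotient of the semigroup at `∫₀ᵗ T(σ) x dσ` is the slope of the primitive at
  -- `t` minus its slope at `0`.
  have h := ((S.hasDerivAt_integral x t).tendsto_slope_zero_right).sub
    ((S.hasDerivAt_integral x 0).tendsto_slope_zero_right)
  rw [S.flow_zero] at h
  refine (h.comp tendsto_coe_nhdsGT_zero).congr fun r => ?_
  have := S.flow_integral x r.2 ht
  rw [← S.flow_coe]
  simp only [Function.comp_apply, zero_add, NNReal.val_eq_coe] at this ⊢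
  rw [this, ← smul_sub]
  congr 1
  rw [S.integral_apply 0, intervalIntegral.integral_same]
  abel

/-- The family `(β - A) ∫₀ᵗ T(σ) dσ = β ∫₀ᵗ T(σ) dσ - T(t) + 1` of bounded operators. -/
noncomputable def C0Semigroup.shiftedIntegral (S : C0Semigroup X) (β : ℂ) (t : ℝ) : X →L[ℂ] X :=
  β • S.integral t - (S.flow t - ContinuousLinearMap.id ℂ X)

theorem C0Semigroup.continuous_shiftedIntegral (S : C0Semigroup X) (β : ℂ) (x : X) :
    Continuous fun t => S.shiftedIntegral β t x := by
  have h1 := S.continuous_integral x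
  have h2 := S.continuous_flow x
  simp only [shiftedIntegral, sub_apply, smul_apply]
  fun_prop

/-- Since `A ∫₀ᵗ T(σ) x dσ = T(t) x - x`, the shifted family really is `β - A` applied to the
integral, and `R(β, A)` undoes it. -/
theorem res_shiftedIntegral {A : X →ₗ.[ℂ] X} {S : C0Semigroup X} (hA : IsGenerator A S)
    (β : resolventSet A) (x : X) {t : ℝ} (ht : 0 ≤ t) :
    res A β (S.shiftedIntegral β t x) = S.integral t x := by
  obtain ⟨y, hy1, hy2⟩ := (LinearPMap.mem_graph_iff A).1 (hA.integral_mem_graph x ht)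
  have := res_left A β y
  simp only at hy1 hy2
  rw [hy1, hy2] at this
  exact this

/-- The domain of a generator is dense. -/
theorem res_denseRange {A : X →ₗ.[ℂ] X} {S : C0Semigroup X} (hA : IsGenerator A S)
    (β : resolventSet A) : DenseRange (res A β) := by
  intro x
  -- The means `t⁻¹ ∫₀ᵗ T(σ) x dσ` lie in the range of the resolvent and tend to `x`.
  have h := (S.hasDerivAt_integral x 0).tendsto_slope_zero_right
  rw [S.flow_zero] at h
  refine mem_closure_of_tendsto h ?_
  filter_upwards [self_mem_nhdsWithin] with t ht
  refine ⟨t⁻¹ • S.shiftedIntegral β t x, ?_⟩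
  rw [ContinuousLinearMap.map_smul_of_tower, res_shiftedIntegral hA β x (le_of_lt ht), zero_add,
    S.integral_apply 0, intervalIntegral.integral_same, sub_zero]

/-- The family `∫₀ᵗ (t - σ) T(σ) dσ`. -/
noncomputable def C0Semigroup.doubleIntegral (S : C0Semigroup X) : ℝ → X →L[ℂ] X :=
  strongPrimitive S.integral S.continuous_integral

/-- The family `(β - A) ∫₀ᵗ (t - σ) T(σ) dσ` of bounded operators. -/
noncomputable def C0Semigroup.shiftedDoubleIntegral (S : C0Semigroup X) (β : ℂ) :
    ℝ → X →L[ℂ] X :=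
  strongPrimitive (S.shiftedIntegral β) (S.continuous_shiftedIntegral β)

theorem C0Semigroup.continuous_shiftedDoubleIntegral (S : C0Semigroup X) (β : ℂ) (x : X) :
    Continuous fun t => S.shiftedDoubleIntegral β t x :=
  continuous_strongPrimitive _ (S.continuous_shiftedIntegral β) x

theorem C0Semigroup.doubleIntegral_apply (S : C0Semigroup X) (x : X) {t : ℝ} (ht : 0 ≤ t) :
    S.doubleIntegral t x = ∫ σ in (0 : ℝ)..t, (t - σ) • S.flow σ x := by
  rw [intervalIntegral_sub_smul_eq ht ((S.continuous_flow x).integrableOn_Ioc)]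
  rfl

theorem res_shiftedDoubleIntegral {A : X →ₗ.[ℂ] X} {S : C0Semigroup X} (hA : IsGenerator A S)
    (β : resolventSet A) (x : X) {t : ℝ} (ht : 0 ≤ t) :
    res A β (S.shiftedDoubleIntegral β t x) = S.doubleIntegral t x := by
  rw [C0Semigroup.shiftedDoubleIntegral, strongPrimitive_apply,
    ← ContinuousLinearMap.intervalIntegral_comp_comm _
      ((S.continuous_shiftedIntegral β x).intervalIntegrable _ _)]
  refine intervalIntegral.integral_congr fun σ hσ => ?_
  rw [uIcc_of_le ht] at hσ
  exact res_shiftedIntegral hA β x hσ.1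

/-- After applying the injective `R(β, A)`, this is commutation of resolvent and semigroup. It makes
the shifted family explicit on the dense set `D(A)`. -/
theorem shiftedDoubleIntegral_res {A : X →ₗ.[ℂ] X} {S : C0Semigroup X} (hA : IsGenerator A S)
    (β : resolventSet A) (x : X) {t : ℝ} (ht : 0 ≤ t) :
    S.shiftedDoubleIntegral β t (res A β x) = S.doubleIntegral t x := by
  apply res_injective A β
  have hc : Continuous fun σ => (t - σ) • S.flow σ x := by
    have := S.continuous_flow x
    fun_prop
  rw [res_shiftedDoubleIntegral hA β _ ht, S.doubleIntegral_apply _ ht, S.doubleIntegral_apply _ ht,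
    ← ContinuousLinearMap.intervalIntegral_comp_comm _ (hc.intervalIntegrable _ _)]
  refine intervalIntegral.integral_congr fun σ _ => ?_
  rw [ContinuousLinearMap.map_smul_of_tower, res_flow hA]

/-- The double primitive of a mild solution is in the range of the resolvent. -/
theorem intervalIntegral_sub_smul_convolution_eq {A : X →ₗ.[ℂ] X} {S : C0Semigroup X}
    (hA : IsGenerator A S) (β : resolventSet A) {w : ℝ → X} {t : ℝ} (ht : 0 ≤ t)
    (hw : IntegrableOn w (Ioc 0 t)) :
    ∫ r in (0 : ℝ)..t, (t - r) • ∫ ρ in (0 : ℝ)..r, S.flow (r - ρ) (w ρ) =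
      res A β (∫ ρ in (0 : ℝ)..t, S.shiftedDoubleIntegral β (t - ρ) (w ρ)) := by
  have hsub : ∀ r ∈ uIcc 0 t, IntegrableOn w (Ioc 0 r) := fun r hr =>
    hw.mono_set (Ioc_subset_Ioc_right (by rw [uIcc_of_le ht] at hr; exact hr.2))
  have h0 : ∀ r ∈ uIcc 0 t, 0 ≤ r := fun r hr => by rw [uIcc_of_le ht] at hr; exact hr.1
  rw [intervalIntegral_sub_smul_eq ht (integrableOn_convolution S.continuous_flow hw)]
  -- Each of the two primitives is moved onto the kernel: `T` becomes its integral, and then its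
  -- double integral.
  have h1 : ∫ r in (0 : ℝ)..t, ∫ s in (0 : ℝ)..r, ∫ ρ in (0 : ℝ)..s, S.flow (s - ρ) (w ρ) =
      ∫ r in (0 : ℝ)..t, ∫ ρ in (0 : ℝ)..r, S.integral (r - ρ) (w ρ) :=
    intervalIntegral.integral_congr fun r hr =>
      integral_convolution_eq S.continuous_flow (h0 r hr) (hsub r hr)
  rw [h1, integral_convolution_eq S.continuous_integral ht hw,
    ← ContinuousLinearMap.intervalIntegral_comp_comm]
  · refine intervalIntegral.integral_congr fun ρ hρ => ?_
    rw [uIcc_of_le ht] at hρ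
    exact (res_shiftedDoubleIntegral hA β (w ρ) (sub_nonneg.2 hρ.2)).symm
  · exact intervalIntegrable_strong_family_apply (K := fun ρ => S.shiftedDoubleIntegral β (t - ρ))
      (fun x => (S.continuous_shiftedDoubleIntegral β x).comp (by fun_prop))
      ((intervalIntegrable_iff_integrableOn_Ioc_of_le ht).2 hw)

end SemigroupCalculus

end LinSys

/-! ### The double primitive as a bounded functional on `L¹` -/

section WeightedIntegral

variable {Y : Type*} [NormedAddCommGroup Y] [NormedSpace ℂ Y]

theorem integrableOn_sub_smul {f : ℝ → Y} {a b t : ℝ} (hf : IntegrableOn f (Ioc a b)) :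
    IntegrableOn (fun σ => (t - σ) • f σ) (Ioc a b) :=
  hf.continuousOn_smul_of_subset (by fun_prop : ContinuousOn (fun σ => t - σ) (Icc a b))
    isCompact_Icc measurableSet_Ioc Ioc_subset_Icc_self

/-- The operator `f ↦ ∫₀ᵗ (t - σ) f σ dσ` on `L¹`. -/
noncomputable def weightedIntegral (t : ℝ) : (ℝ →₁[volume] Y) →L[ℂ] Y :=
  LinearMap.mkContinuous
    { toFun := fun g => ∫ σ in Ioc 0 t, (t - σ) • g σ
      map_add' := fun g h => by
        rw [← integral_add (integrableOn_sub_smul (L1.integrable_coeFn g).integrableOn)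
          (integrableOn_sub_smul (L1.integrable_coeFn h).integrableOn)]
        refine integral_congr_ae (ae_restrict_of_ae ?_)
        filter_upwards [Lp.coeFn_add g h] with σ hσ
        rw [hσ, Pi.add_apply, smul_add]
      map_smul' := fun k g => by
        rw [RingHom.id_apply, ← integral_smul]
        refine integral_congr_ae (ae_restrict_of_ae ?_)
        filter_upwards [Lp.coeFn_smul k g] with σ hσ
        rw [hσ, Pi.smul_apply, smul_comm] }
    |t| fun g => by
      refine (norm_integral_le_integral_norm _).trans ?_
      rw [L1.norm_eq_integral_norm, ← integral_const_mul]
      have hg := (L1.integrable_coeFn g).norm.const_mul |t|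
      refine (setIntegral_mono_on (integrableOn_sub_smul
        (L1.integrable_coeFn g).integrableOn).norm hg.integrableOn measurableSet_Ioc
        fun σ hσ => ?_).trans (setIntegral_le_integral hg (.of_forall fun σ => by positivity))
      rw [norm_smul, Real.norm_eq_abs]
      refine mul_le_mul_of_nonneg_right ?_ (norm_nonneg _)
      rw [abs_of_nonneg (sub_nonneg.2 hσ.2), abs_of_pos (hσ.1.trans_le hσ.2)]
      linarith [hσ.1]

theorem weightedIntegral_apply (t : ℝ) (g : ℝ →₁[volume] Y) :
    weightedIntegral t g = ∫ σ in Ioc 0 t, (t - σ) • g σ := rfl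

end WeightedIntegral

/-! ### The output map on initial states; here `C` stands for the bounded operator `C R(β, A)` -/

namespace LinSys

section OutputMap

variable {X Y : Type*} [NormedAddCommGroup X] [NormedSpace ℂ X]
  [NormedAddCommGroup Y] [NormedSpace ℂ Y]

/-- The output `σ ↦ C T(σ) y`, extended by zero to negative times and delayed by `r`. -/
noncomputable def delayedOrbit (S : C0Semigroup X) (C : X →L[ℂ] Y) (r : ℝ) (y : X) : ℝ → Y :=
  (Ici r).indicator fun σ => C (S.flow (σ - r) y)

theorem aestronglyMeasurable_delayedOrbit (S : C0Semigroup X) (C : X →L[ℂ] Y) (r : ℝ) (y : X) :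
    AEStronglyMeasurable (delayedOrbit S C r y) volume :=
  ((C.continuous.comp (S.continuous_flow y)).comp
    (continuous_id.sub continuous_const)).aestronglyMeasurable.indicator measurableSet_Ici

/-- Monotone convergence turns bounds uniform in `t` into one on the half-line; this is where
infinite-time admissibility gives global integrability. -/
theorem lintegral_delayedOrbit_le {S : C0Semigroup X} {C : X →L[ℂ] Y} {y : X} {b : ℝ≥0∞}
    (h : ∀ t : ℝ, 0 < t → eLpNorm (fun σ => C (S.flow σ y)) 1 (volume.restrict (Icc 0 t)) ≤ b) :
    ∫⁻ σ, ‖delayedOrbit S C 0 y σ‖ₑ ≤ b := by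
  have e : ∀ σ, ‖delayedOrbit S C 0 y σ‖ₑ = (Ici 0).indicator (fun σ => ‖C (S.flow σ y)‖ₑ) σ := by
    intro σ
    rw [delayedOrbit, enorm_indicator_eq_indicator_enorm]
    simp
  -- The endpoints are `n + 1` because `h` requires `0 < t`.
  have hu : Ici (0 : ℝ) = ⋃ n : ℕ, Icc (0 : ℝ) (n + 1) := by
    ext σ
    simp only [mem_Ici, mem_iUnion, mem_Icc, exists_and_left, iff_self_and]
    intro _
    obtain ⟨n, hn⟩ := exists_nat_ge σ
    exact ⟨n, by linarith⟩
  simp only [e]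
  rw [lintegral_indicator measurableSet_Ici, hu, setLIntegral_iUnion_of_directed]
  · refine iSup_le fun n => ?_
    rw [← eLpNorm_one_eq_lintegral_enorm]
    exact h _ (by positivity)
  · exact (monotone_nat_of_le_succ fun n => Icc_subset_Icc_right (by simp)).directed_le

variable [CompleteSpace X] [CompleteSpace Y]

/-- Admissibility makes the output map a bounded operator into `L¹`; together with its delays it
forms a bounded strongly continuous family. -/
theorem exists_delayed_output_map {A : X →ₗ.[ℂ] X} {S : C0Semigroup X} (hA : IsGenerator A S)
    (β : resolventSet A) (C : X →L[ℂ] Y) {c : ℝ}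
    (hc : 0 ≤ c) (hC : ∀ y, ∀ t : ℝ, 0 < t → eLpNorm (fun σ => C (S.flow σ y)) 1 (volume.restrict (Icc 0 t))
      ≤ ENNReal.ofReal (c * ‖res A β y‖)) :
    ∃ K : ℝ → X →L[ℂ] (ℝ →₁[volume] Y), (∀ x, Continuous fun r => K r x) ∧
      (∀ r x, ‖K r x‖ ≤ c * ‖x‖) ∧
      ∀ r y, K r (res A β y) =ᵐ[volume] delayedOrbit S C r y := by
  have hle := fun y => lintegral_delayedOrbit_le (hC y)
  have hint : ∀ y, Integrable (delayedOrbit S C 0 y) := fun y =>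
    ⟨aestronglyMeasurable_delayedOrbit S C 0 y, (hle y).trans_lt ENNReal.ofReal_lt_top⟩
  let Φ : X →ₗ[ℂ] (ℝ →₁[volume] Y) :=
    { toFun := fun y => (hint y).toL1 _
      map_add' := fun x y => by
        rw [← Integrable.toL1_add, Integrable.toL1_eq_toL1_iff]
        refine .of_forall fun σ => ?_
        simp only [delayedOrbit, Pi.add_apply, indicator, map_add]
        split_ifs <;> simp
      map_smul' := fun k x => by
        rw [RingHom.id_apply, ← Integrable.toL1_smul, Integrable.toL1_eq_toL1_iff]
        refine .of_forall fun σ => ?_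
        simp only [delayedOrbit, indicator, map_smul]
        split_ifs <;> simp }
  have hd : DenseRange (res A β).toLinearMap := res_denseRange hA β
  have hn : ∀ y, ‖Φ y‖ ≤ c * ‖(res A β).toLinearMap y‖ := by
    intro y
    change ‖(hint y).toL1 _‖ ≤ c * ‖res A β y‖
    rw [Integrable.norm_toL1_eq_lintegral_enorm]
    exact ENNReal.toReal_le_of_le_ofReal (by positivity) (hle y)
  -- `Ψ` sends `R(β, A) y` to `Φ y`, so it extends the output map from `D(A)` to `X`; by `hn` it is
  -- well defined and bounded by `c`.
  let Ψ := Φ.extendOfNorm (res A β).toLinearMap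
  have hmp : ∀ r : ℝ, MeasurePreserving (fun σ : ℝ => σ - r) volume volume :=
    fun r => measurePreserving_sub_right volume r
  -- Extension by zero to all of `ℝ` makes the delay an isometry of `L¹`, and translations are
  -- strongly continuous there.
  refine ⟨fun r => (Lp.compMeasurePreservingₗᵢ ℂ _ (hmp r)).toContinuousLinearMap.comp Ψ,
    fun x => ?_, fun r x => ?_, fun r y => ?_⟩
  · refine Continuous.compMeasurePreservingLp (f := fun _ => Ψ x)
      (g := fun r : ℝ => (⟨fun σ : ℝ => σ - r, by fun_prop⟩ : C(ℝ, ℝ))) continuous_const ?_ hmp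
      ENNReal.one_ne_top
    exact ContinuousMap.continuous_of_continuous_uncurry _
      (continuous_snd.sub continuous_fst)
  · exact ((Lp.compMeasurePreservingₗᵢ ℂ _ (hmp r)).norm_map (Ψ x)).trans_le
      (LinearMap.norm_extendOfNorm_apply_le hd c hn x)
  · have h1 : Ψ (res A β y) = (hint y).toL1 _ := LinearMap.extendOfNorm_eq hd ⟨c, hn⟩ y
    change Lp.compMeasurePreserving _ (hmp r) (Ψ (res A β y)) =ᵐ[volume] _
    rw [h1]
    refine (Lp.coeFn_compMeasurePreserving _ (hmp r)).trans ?_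
    refine ((hmp r).quasiMeasurePreserving.ae_eq_comp (hint y).coeFn_toL1).trans ?_
    refine .of_forall fun σ => ?_
    simp [delayedOrbit, indicator]

end OutputMap

end LinSys

/-! ### The output produced by an input with values in `X` -/

namespace LinSys

section OutputOfInput

variable {X Y : Type*} [NormedAddCommGroup X] [NormedSpace ℂ X] [CompleteSpace X]
  [NormedAddCommGroup Y] [NormedSpace ℂ Y]
  {A : X →ₗ.[ℂ] X} {S : C0Semigroup X} {β : resolventSet A} {C : X →L[ℂ] Y}
  {K : ℝ → X →L[ℂ] (ℝ →₁[volume] Y)} {c : ℝ}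

/-- Up to time `t < r`, an output delayed by `r` vanishes. -/
theorem restrict_delayed_output_eq_zero (hA : IsGenerator A S)
    (hK : ∀ r y, K r (res A β y) =ᵐ[volume] delayedOrbit S C r y) {r t : ℝ} (h : t < r) (x : X) :
    LpToLpRestrictCLM ℝ Y ℂ volume 1 (Iic t) (K r x) = 0 := by
  refine (res_denseRange hA β).induction_on x (isClosed_eq (by fun_prop) continuous_const)
    fun y => ?_
  rw [Lp.eq_zero_iff_ae_eq_zero]
  refine (LpToLpRestrictCLM_coeFn ℂ _ _).trans ?_
  filter_upwards [ae_restrict_of_ae (hK r y), ae_restrict_mem measurableSet_Iic] with σ h1 h2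
  rw [h1, delayedOrbit, indicator_of_notMem, Pi.zero_apply]
  exact fun h3 => absurd (h3.trans h2) (not_le.2 h)

theorem integrable_delayed_output (hKc : ∀ x, Continuous fun r => K r x)
    (hKb : ∀ r x, ‖K r x‖ ≤ c * ‖x‖) {w : ℝ → X} (hw : Integrable w) :
    Integrable fun r => K r (w r) := by
  refine (hw.norm.const_mul c).mono' ?_ (.of_forall fun r => hKb r (w r))
  exact (continuous_apply_of_strongly_continuous hKc).comp_aestronglyMeasurable
    (continuous_id.aestronglyMeasurable.prodMk hw.aestronglyMeasurable)

variable [CompleteSpace Y]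

/-- Both sides are continuous in `x`, so it suffices to take `x = R(β, A) y`. There the delayed
output is an explicit orbit, and a shift of the variable by `r` gives the identity. -/
theorem weightedIntegral_delayed_output (hA : IsGenerator A S)
    (hK : ∀ r y, K r (res A β y) =ᵐ[volume] delayedOrbit S C r y) {r t : ℝ} (h0 : 0 ≤ r)
    (h : r ≤ t) (x : X) :
    weightedIntegral t (K r x) = C (S.shiftedDoubleIntegral β (t - r) x) := by
  refine (res_denseRange hA β).induction_on x (isClosed_eq (by fun_prop) (by fun_prop))
    fun y => ?_
  have hc : Continuous fun σ => (t - r - σ) • S.flow σ y := by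
    have := S.continuous_flow y
    fun_prop
  rw [shiftedDoubleIntegral_res hA β y (sub_nonneg.2 h), S.doubleIntegral_apply y (sub_nonneg.2 h),
    ← ContinuousLinearMap.intervalIntegral_comp_comm _ (hc.intervalIntegrable _ _),
    weightedIntegral_apply]
  have e1 : ∫ σ in Ioc 0 t, (t - σ) • K r (res A β y) σ =
      ∫ σ in Ioc 0 t, (Ici r).indicator (fun σ => (t - σ) • C (S.flow (σ - r) y)) σ := by
    refine integral_congr_ae (ae_restrict_of_ae ?_)
    filter_upwards [hK r y] with σ hσ
    rw [hσ, delayedOrbit, indicator_smul_apply]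
  have e2 : ∫ σ in (0 : ℝ)..(t - r), C ((t - r - σ) • S.flow σ y) =
      ∫ σ in r..t, (t - σ) • C (S.flow (σ - r) y) := by
    have := intervalIntegral.integral_comp_sub_right (a := r) (b := t)
      (fun σ => C ((t - r - σ) • S.flow σ y)) r
    rw [sub_self] at this
    rw [← this]
    refine intervalIntegral.integral_congr fun σ _ => ?_
    simp only [ContinuousLinearMap.map_smul_of_tower, sub_sub_sub_cancel_right]
  rw [e1, e2, setIntegral_indicator measurableSet_Ici, intervalIntegral.integral_of_le h]
  -- The intersection of `(0, t]` with `[r, ∞)` contains its left endpoint `r` exactly when `r > 0`.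
  rcases h0.eq_or_lt with rfl | h0
  · congr 2
    ext σ; simp only [mem_inter_iff, mem_Ioc, mem_Ici]; grind
  · rw [← integral_Icc_eq_integral_Ioc]
    congr 2
    ext σ; simp only [mem_inter_iff, mem_Ioc, mem_Ici, mem_Icc]; grind

/-- Causality: input after time `t` contributes nothing to the output up to time `t`. -/
theorem restrict_integral_delayed_output (hA : IsGenerator A S)
    (hKc : ∀ x, Continuous fun r => K r x) (hKb : ∀ r x, ‖K r x‖ ≤ c * ‖x‖)
    (hK : ∀ r y, K r (res A β y) =ᵐ[volume] delayedOrbit S C r y) {w : ℝ → X}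
    (hw : Integrable w) (t : ℝ) :
    LpToLpRestrictCLM ℝ Y ℂ volume 1 (Iic t) (∫ r, K r (w r)) =
      ∫ r in Iic t, LpToLpRestrictCLM ℝ Y ℂ volume 1 (Iic t) (K r (w r)) := by
  rw [← ContinuousLinearMap.integral_comp_comm _ (integrable_delayed_output hKc hKb hw),
    setIntegral_eq_integral_of_forall_compl_eq_zero]
  exact fun r hr => restrict_delayed_output_eq_zero hA hK (not_le.1 hr) _

/-- Once causality has cut the integral at `t`, this is the triangle inequality for an `L¹`-valued
integral. -/
theorem eLpNorm_integral_delayed_output_le (hA : IsGenerator A S) (hc : 0 ≤ c)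
    (hKc : ∀ x, Continuous fun r => K r x) (hKb : ∀ r x, ‖K r x‖ ≤ c * ‖x‖)
    (hK : ∀ r y, K r (res A β y) =ᵐ[volume] delayedOrbit S C r y) {w : ℝ → X}
    (hw : Integrable w) (t : ℝ) :
    eLpNorm (∫ r, K r (w r) : ℝ →₁[volume] Y) 1 (volume.restrict (Iic t)) ≤
      ENNReal.ofReal c * eLpNorm w 1 (volume.restrict (Iic t)) := by
  rw [← eLpNorm_congr_ae (LpToLpRestrictCLM_coeFn ℂ (Iic t) _), ← Lp.enorm_def,
    restrict_integral_delayed_output hA hKc hKb hK hw, eLpNorm_one_eq_lintegral_enorm,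
    ← lintegral_const_mul' _ _ ENNReal.ofReal_ne_top]
  refine (enorm_integral_le_lintegral_enorm _).trans (lintegral_mono fun r => ?_)
  rw [← ofReal_norm, ← ofReal_norm, ← ENNReal.ofReal_mul hc]
  refine ENNReal.ofReal_le_ofReal (le_trans ?_ (hKb r (w r)))
  exact norm_Lp_toLp_restrict_le _ _

/-- Both operators pass through the integrals, which leaves a comparison of integrands: equal on
`(0, t]`, zero before because `w` vanishes and zero afterwards by causality. -/
theorem weightedIntegral_integral_delayed_output (hA : IsGenerator A S)
    (hKc : ∀ x, Continuous fun r => K r x) (hKb : ∀ r x, ‖K r x‖ ≤ c * ‖x‖)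
    (hK : ∀ r y, K r (res A β y) =ᵐ[volume] delayedOrbit S C r y) {w : ℝ → X}
    (hw : Integrable w) (hw0 : ∀ r ≤ 0, w r = 0) {t : ℝ} (ht : 0 ≤ t) :
    weightedIntegral t (∫ r, K r (w r)) =
      C (∫ r in (0 : ℝ)..t, S.shiftedDoubleIntegral β (t - r) (w r)) := by
  rw [← ContinuousLinearMap.intervalIntegral_comp_comm,
    ← ContinuousLinearMap.integral_comp_comm _ (integrable_delayed_output hKc hKb hw),
    ← setIntegral_eq_integral_of_forall_compl_eq_zero (s := Ioc 0 t),
    intervalIntegral.integral_of_le ht]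
  · exact setIntegral_congr_fun measurableSet_Ioc fun r hr =>
      weightedIntegral_delayed_output hA hK hr.1.le hr.2 _
  · intro r hr
    rcases le_or_gt r 0 with h | h
    · rw [hw0 r h, map_zero, map_zero]
    · have htr : t < r := not_le.1 fun h' => hr ⟨h, h'⟩
      have h1 := restrict_delayed_output_eq_zero hA hK htr (w r)
      rw [Lp.eq_zero_iff_ae_eq_zero] at h1
      have h2 := (LpToLpRestrictCLM_coeFn ℂ (Iic t) (K r (w r))).symm.trans h1
      rw [weightedIntegral_apply]
      refine integral_eq_zero_of_ae ?_
      filter_upwards [ae_restrict_of_ae_restrict_of_subset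
        (fun _ h => h.2 : Ioc 0 t ⊆ Iic t) h2] with σ hσ
      rw [hσ, Pi.zero_apply, smul_zero]
  · exact intervalIntegrable_strong_family_apply (K := fun r => S.shiftedDoubleIntegral β (t - r))
      (fun x => (S.continuous_shiftedDoubleIntegral β x).comp (by fun_prop))
      hw.intervalIntegrable

/-- For a bounded input `w` with values in the state space there is an output `f` in `L¹_loc`,
with the admissibility estimate, whose double primitive is the observation of the double primitive
of the mild solution. -/
theorem exists_output (hA : IsGenerator A S) (hc : 0 ≤ c)
    (hC : ∀ y, ∀ t : ℝ, 0 < t → eLpNorm (fun σ => C (S.flow σ y)) 1 (volume.restrict (Icc 0 t))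
      ≤ ENNReal.ofReal (c * ‖res A β y‖)) {w : ℝ → X} (hw : LocallyIntegrableOn w (Ici 0)) :
    ∃ f : ℝ → Y, LocallyIntegrableOn f (Ici 0) ∧
      (∀ t, 0 ≤ t → ∫ σ in (0 : ℝ)..t, (t - σ) • f σ =
        C (∫ r in (0 : ℝ)..t, S.shiftedDoubleIntegral β (t - r) (w r))) ∧
      ∀ t, eLpNorm f 1 (volume.restrict (Icc 0 t)) ≤
        ENNReal.ofReal c * eLpNorm w 1 (volume.restrict (Icc 0 t)) := by
  obtain ⟨K, hKc, hKb, hK⟩ := exists_delayed_output_map hA β C hc hC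
  -- The input is only locally integrable, so it is truncated at integer times; by causality the
  -- outputs `F m` and `F n` agree up to time `m ≤ n`.
  let v : ℕ → ℝ → X := fun n => (Ioc (0 : ℝ) n).indicator w
  have hv : ∀ n, Integrable (v n) := fun n =>
    ((hw.integrableOn_compact_subset Icc_subset_Ici_self isCompact_Icc).mono_set
      Ioc_subset_Icc_self).integrable_indicator measurableSet_Ioc
  let F : ℕ → (ℝ →₁[volume] Y) := fun n => ∫ r, K r (v n r)
  have hF : ∀ m n : ℕ, m ≤ n → F m =ᵐ[volume.restrict (Iic (m : ℝ))] F n := by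
    intro m n hmn
    have e : LpToLpRestrictCLM ℝ Y ℂ volume 1 (Iic (m : ℝ)) (F m) =
        LpToLpRestrictCLM ℝ Y ℂ volume 1 (Iic (m : ℝ)) (F n) := by
      rw [restrict_integral_delayed_output hA hKc hKb hK (hv m),
        restrict_integral_delayed_output hA hKc hKb hK (hv n)]
      refine setIntegral_congr_fun measurableSet_Iic fun r hr => ?_
      have : v m r = v n r := by
        have h1 : r ≤ (n : ℝ) := le_trans hr (Nat.cast_le.2 hmn)
        simp only [mem_Iic] at hr
        simp [v, indicator, hr, h1]
      simp only [this]
    exact ((LpToLpRestrictCLM_coeFn ℂ _ _).symm.trans (.of_eq (by rw [e]))).trans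
      (LpToLpRestrictCLM_coeFn ℂ _ _)
  -- The outputs are glued by using `F n` on `(n - 1, n]`; only countably many a.e. identities are
  -- involved.
  let f : ℝ → Y := fun σ => F ⌈σ⌉₊ σ
  have hf : ∀ n : ℕ, f =ᵐ[volume.restrict (Iic (n : ℝ))] F n := by
    intro n
    have h1 : ∀ᵐ σ ∂(volume : Measure ℝ), ∀ m : ℕ, m ≤ n → σ ∈ Iic (m : ℝ) → F m σ = F n σ := by
      rw [ae_all_iff]
      intro m
      by_cases hmn : m ≤ n
      · filter_upwards [(ae_restrict_iff' measurableSet_Iic).1 (hF m n hmn)] with σ hσ _ using hσ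
      · exact .of_forall fun σ h => absurd h hmn
    filter_upwards [ae_restrict_of_ae h1, ae_restrict_mem measurableSet_Iic] with σ h2 h3
    exact h2 _ (Nat.ceil_le.2 h3) (Nat.le_ceil σ)
  have hfs : ∀ (n : ℕ) (s : Set ℝ), s ⊆ Iic (n : ℝ) → f =ᵐ[volume.restrict s] F n :=
    fun n s hs => ae_restrict_of_ae_restrict_of_subset hs (hf n)
  refine ⟨f, ?_, fun t ht => ?_, fun t => ?_⟩
  · rw [locallyIntegrableOn_iff isClosed_Ici.isLocallyClosed]
    intro k _ hk
    obtain ⟨b, hb⟩ := hk.bddAbove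
    obtain ⟨n, hn⟩ := exists_nat_ge b
    exact (L1.integrable_coeFn (F n)).integrableOn.congr
      (hfs n k fun σ hσ => (hb hσ).trans hn).symm
  · obtain ⟨n, hn⟩ := exists_nat_ge t
    have e := weightedIntegral_integral_delayed_output hA hKc hKb hK (hv n)
      (fun r hr => indicator_of_notMem (fun h => absurd h.1 (not_lt.2 hr)) _) ht
    rw [weightedIntegral_apply] at e
    rw [intervalIntegral.integral_of_le ht]
    refine Eq.trans (integral_congr_ae ?_) (e.trans (congrArg C ?_))
    · filter_upwards [hfs n (Ioc 0 t) fun σ hσ => hσ.2.trans hn] with σ hσ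
      rw [hσ]
    · rw [intervalIntegral.integral_of_le ht, intervalIntegral.integral_of_le ht]
      refine setIntegral_congr_fun measurableSet_Ioc fun r hr => ?_
      simp only [v]
      rw [indicator_of_mem (show r ∈ Ioc (0 : ℝ) n from ⟨hr.1, hr.2.trans hn⟩)]
  · obtain ⟨n, hn⟩ := exists_nat_ge t
    rw [eLpNorm_congr_ae (hfs n (Icc 0 t) fun σ hσ => hσ.2.trans hn)]
    refine (eLpNorm_mono_measure _ (Measure.restrict_mono_set volume
      (fun _ h => h.2 : Icc 0 t ⊆ Iic t))).trans ?_
    refine (eLpNorm_integral_delayed_output_le hA hc hKc hKb hK (hv n) t).trans ?_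
    gcongr
    simp only [v]
    rw [eLpNorm_indicator_eq_eLpNorm_restrict measurableSet_Ioc,
      Measure.restrict_restrict measurableSet_Ioc]
    exact eLpNorm_mono_measure _ (Measure.restrict_mono_set volume
      fun _ h => ⟨h.1.1.le, h.2⟩)

end OutputOfInput

end LinSys

/-! ### Second distributional derivatives on the half-line -/

section SecondDerivative

variable {Y : Type*} [NormedAddCommGroup Y] [NormedSpace ℝ Y] [CompleteSpace Y]

/-- Taylor's formula with integral remainder, expanded at `b`, where `φ` vanishes to first order. -/
theorem intervalIntegral_mul_iteratedDeriv_two {φ : ℝ → ℝ} (hφ : ContDiff ℝ 2 φ) {a b : ℝ}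
    (h0 : φ b = 0) (h1 : deriv φ b = 0) :
    ∫ t in a..b, iteratedDeriv 2 φ t * (t - a) = φ a := by
  have hd : Differentiable ℝ φ := hφ.differentiable (by norm_num)
  have hd1 : ContDiff ℝ 1 (deriv φ) := hφ.deriv' (n := 1)
  have hd2 : Differentiable ℝ (deriv φ) := hd1.differentiable (by norm_num)
  have e : iteratedDeriv 2 φ = deriv (deriv φ) := by
    rw [iteratedDeriv_succ, iteratedDeriv_one]
  have hc : Continuous (deriv (deriv φ)) := hd1.continuous_deriv le_rfl
  rw [e, intervalIntegral.integral_eq_sub_of_hasDerivAt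
    (f := fun t => deriv φ t * (t - a) - φ t)]
  · simp [h0, h1]
  · intro t _
    have := ((hd2 t).hasDerivAt.mul ((hasDerivAt_id t).sub_const a)).sub (hd t).hasDerivAt
    convert! this using 1
    simp
  · exact (hc.mul (by fun_prop)).intervalIntegrable _ _

/-- If `h` is the double primitive of `f`, then `f` is the second distributional derivative
of `h` on `[0,∞)`. -/
theorem integral_iteratedDeriv_two_smul {φ : ℝ → ℝ} (hφ : ContDiff ℝ 2 φ)
    (hs : HasCompactSupport φ) {f h : ℝ → Y} (hf : LocallyIntegrableOn f (Ici 0))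
    (hh : ∀ t, 0 ≤ t → h t = ∫ σ in (0 : ℝ)..t, (t - σ) • f σ) :
    ∫ t in Ici (0 : ℝ), iteratedDeriv 2 φ t • h t = ∫ t in Ici (0 : ℝ), φ t • f t := by
  have e : iteratedDeriv 2 φ = deriv (deriv φ) := by
    rw [iteratedDeriv_succ, iteratedDeriv_one]
  have hs2 : HasCompactSupport (iteratedDeriv 2 φ) := by rw [e]; exact hs.deriv.deriv
  have hc2 : Continuous (iteratedDeriv 2 φ) := hφ.continuous_iteratedDeriv 2 le_rfl
  -- The bound is strict so that the cut-off `m` itself lies outside the support and `φ`, `φ'`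
  -- vanish there.
  obtain ⟨M, hM⟩ : ∃ M : ℝ, ∀ t ∈ tsupport φ, t < M := by
    obtain ⟨b, hb⟩ := IsCompact.bddAbove hs
    exact ⟨b + 1, fun t ht => (hb ht).trans_lt (lt_add_one b)⟩
  set m := max M 0
  have hm0 : 0 ≤ m := le_max_right _ _
  have hm : ∀ t, m ≤ t → t ∉ tsupport φ := fun t ht h =>
    absurd (hM t h) (not_lt.2 ((le_max_left _ _).trans ht))
  have hφ0 : ∀ t, m ≤ t → φ t = 0 := fun t ht => image_eq_zero_of_notMem_tsupport (hm t ht)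
  have hφ1 : ∀ t, m ≤ t → deriv φ t = 0 := fun t ht =>
    image_eq_zero_of_notMem_tsupport fun h => hm t ht (tsupport_deriv_subset h)
  have hφ2 : ∀ t, m ≤ t → iteratedDeriv 2 φ t = 0 := fun t ht => by
    rw [e]
    exact image_eq_zero_of_notMem_tsupport fun h =>
      hm t ht (tsupport_deriv_subset (tsupport_deriv_subset h))
  have hcut : ∀ g : ℝ → Y, (∀ t, m ≤ t → g t = 0) →
      ∫ t in Ici (0 : ℝ), g t = ∫ t in (0 : ℝ)..m, g t := by
    intro g hg
    rw [integral_Ici_eq_integral_Ioi, intervalIntegral.integral_of_le hm0]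
    refine setIntegral_eq_of_subset_of_forall_sdiff_eq_zero measurableSet_Ioi
      (fun _ h => h.1) fun t ht => hg t ?_
    by_contra h
    exact ht.2 ⟨ht.1, (not_le.1 h).le⟩
  rw [hcut _ fun t ht => by rw [hφ2 t ht, zero_smul],
    hcut _ fun t ht => by rw [hφ0 t ht, zero_smul]]
  have hfi : IntegrableOn f (Ioc 0 m) :=
    (hf.integrableOn_compact_subset Icc_subset_Ici_self isCompact_Icc).mono_set
      Ioc_subset_Icc_self
  have hfub : Integrable (Function.uncurry fun t σ => (iteratedDeriv 2 φ t * (t - σ)) • f σ)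
      ((volume.restrict (Ioc 0 m)).prod (volume.restrict (Ioc 0 m))) :=
    integrable_prod_strong_family_apply
      (K := fun p => (iteratedDeriv 2 φ p.1 * (p.1 - p.2)) • ContinuousLinearMap.id ℝ Y)
      (fun x => by simp only [smul_apply]; fun_prop) hfi
  have e1 : ∫ t in (0 : ℝ)..m, iteratedDeriv 2 φ t • h t =
      ∫ t in (0 : ℝ)..m, ∫ σ in (0 : ℝ)..t, (iteratedDeriv 2 φ t * (t - σ)) • f σ := by
    refine intervalIntegral.integral_congr fun t ht => ?_
    rw [uIcc_of_le hm0] at ht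
    rw [hh t ht.1, ← intervalIntegral.integral_smul]
    simp only [mul_smul]
  -- After the swap, Taylor's formula turns the inner integral into `φ σ`. No boundary term at `0`
  -- arises, although `φ` need not vanish there.
  rw [e1, intervalIntegral_integral_swap_triangle hm0 hfub]
  refine intervalIntegral.integral_congr fun σ _ => ?_
  rw [intervalIntegral.integral_smul_const,
    intervalIntegral_mul_iteratedDeriv_two hφ (hφ0 m le_rfl) (hφ1 m le_rfl)]

end SecondDerivative

/-! ### Local integrability and bounded operators -/

section LocallyIntegrable

variable {U E : Type*} [NormedAddCommGroup U] [NormedSpace ℂ U]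
  [NormedAddCommGroup E] [NormedSpace ℂ E] {u : ℝ → U}

theorem MeasureTheory.LocallyIntegrableOn.clm_comp (hu : LocallyIntegrableOn u (Ici 0))
    (L : U →L[ℂ] E) : LocallyIntegrableOn (fun r => L (u r)) (Ici 0) := by
  rw [locallyIntegrableOn_iff isClosed_Ici.isLocallyClosed]
  exact fun k hk hkc => L.integrable_comp (hu.integrableOn_compact_subset hk hkc)

theorem MeasureTheory.LocallyIntegrableOn.integrableOn_Ioc_zero {U : Type*}
    [NormedAddCommGroup U] {u : ℝ → U} (hu : LocallyIntegrableOn u (Ici 0)) (t : ℝ) :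
    IntegrableOn u (Ioc 0 t) :=
  (hu.integrableOn_compact_subset Icc_subset_Ici_self isCompact_Icc).mono_set Ioc_subset_Icc_self

theorem intervalIntegrable_sub_smul {t : ℝ} (ht : 0 ≤ t) (hu : IntegrableOn u (Ioc 0 t)) :
    IntervalIntegrable (fun σ => (t - σ) • u σ) volume 0 t :=
  (intervalIntegrable_iff_integrableOn_Ioc_of_le ht).2 (integrableOn_sub_smul hu)

theorem eLpNorm_clm_comp_le {μ : Measure ℝ} (L : U →L[ℂ] E) :
    eLpNorm (fun r => L (u r)) 1 μ ≤ ENNReal.ofReal ‖L‖ * eLpNorm u 1 μ :=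
  eLpNorm_le_mul_eLpNorm_of_ae_le_mul (.of_forall fun r => L.le_opNorm (u r)) 1

end LocallyIntegrable

/-! ### System nodes with bounded input operator -/

namespace LinSys

section ResolventIntoDomain

variable {X : Type*} [NormedAddCommGroup X] [NormedSpace ℂ X] (A : X →ₗ.[ℂ] X)
  (β : resolventSet A)

/-- The resolvent `R(s, A)` as a bounded operator from `X` to `X₁`. -/
noncomputable def resOne (s : resolventSet A) : X →L[ℂ] XOne A β :=
  LinearMap.mkContinuous
    { toFun := fun x => XOne.mk A β (res A s x) (res_mem A s x)
      map_add' := fun x y => Subtype.ext (map_add (res A s) x y)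
      map_smul' := fun c x => Subtype.ext (map_smul (res A s) c x) }
    (1 + ‖(β : ℂ) - s‖ * ‖res A s‖) fun x => by
      have h : XOne.shift A β (XOne.mk A β (res A s x) (res_mem A s x)) =
          x + ((β : ℂ) - s) • res A s x := by
        change (β : ℂ) • res A s x - A ⟨res A s x, res_mem A s x⟩ = _
        have h := res_right A s x
        rw [sub_eq_iff_eq_add, ← sub_eq_iff_eq_add'] at h
        rw [sub_smul, ← h]
        abel
      change ‖XOne.mk A β (res A s x) (res_mem A s x)‖ ≤ _
      rw [XOne.norm_eq, h, add_mul, one_mul, mul_assoc]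
      refine (norm_add_le _ _).trans ?_
      rw [norm_smul]
      gcongr
      exact (res A s).le_opNorm x

theorem incl_resOne (s : resolventSet A) (x : X) :
    XOne.incl A β (resOne A β s x) = res A s x := rfl

/-- The embedding of `X` into `X₋₁` as a bounded operator. -/
noncomputable def embCLM : X →L[ℂ] XMinus A β :=
  (emb A β).mkContinuous ‖res A β‖ fun x => by
    rw [norm_emb]; exact (res A β).le_opNorm x

theorem emb_resolvent_mem_extGraph (s : resolventSet A) (x : X) :
    (emb A β (res A s x), emb A β ((s : ℂ) • res A s x - x)) ∈ extGraph A β := by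
  refine Submodule.le_topologicalClosure _ ⟨(res A s x, (s : ℂ) • res A s x - x), ?_, rfl⟩
  refine (LinearPMap.mem_graph_iff A).2 ⟨⟨res A s x, res_mem A s x⟩, rfl, ?_⟩
  have := res_right A s x
  rw [sub_eq_iff_eq_add'] at this
  exact eq_sub_of_add_eq this.symm

end ResolventIntoDomain

namespace SystemNode

variable {U X Y : Type*} [NormedAddCommGroup U] [NormedSpace ℂ U]
  [NormedAddCommGroup X] [NormedSpace ℂ X] [CompleteSpace X]
  [NormedAddCommGroup Y] [NormedSpace ℂ Y]
  (N : SystemNode U X Y)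

/-- The bounded operator `C R(β, A)`. -/
noncomputable def observation : X →L[ℂ] Y := N.C.comp (resOne N.A N.β N.β)

/-- Admissibility is applied at the state `R(β, A) y`; commuting the resolvent past the semigroup
places it next to `C`. -/
theorem IsInfTimeL1ObsAdmissible.exists_bound {N : SystemNode U X Y}
    (hC : N.IsInfTimeL1ObsAdmissible) :
    ∃ c : ℝ, 0 < c ∧ ∀ y, ∀ t : ℝ, 0 < t →
      eLpNorm (fun σ => N.observation (N.S.flow σ y)) 1 (volume.restrict (Icc 0 t)) ≤
        ENNReal.ofReal (c * ‖res N.A N.β y‖) := by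
  obtain ⟨c, hc, h⟩ := hC
  refine ⟨c, hc, fun y t ht => ?_⟩
  have := h t ht (resOne N.A N.β N.β y)
  rw [incl_resOne] at this
  refine le_of_eq_of_le (congrArg (fun g => eLpNorm g 1 _) (funext fun σ => ?_)) this
  refine congrArg N.C (Subtype.ext ?_)
  exact res_comm N.isGenerator N.β σ.toNNReal y

/-- With a bounded input operator the transfer function is `D + C R(s, A) B`, for some bounded
feedthrough operator `D`. -/
theorem exists_feedthrough {B₀ : U →L[ℂ] X} (hB : ∀ u, N.B u = N.ι (B₀ u)) :
    ∃ D : U →L[ℂ] Y, ∀ s : resolventSet N.A, (s : ℂ) ∈ N.S.halfPlane → ∀ u,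
      N.G s u = D u + N.C (resOne N.A N.β s (B₀ u)) := by
  by_cases hs : ∃ r : resolventSet N.A, (r : ℂ) ∈ N.S.halfPlane
  · obtain ⟨r, hr⟩ := hs
    -- `D = G(r) - C R(r, A) B₀` for one point `r`; the transfer identity makes it the same for all
    -- `s`.
    refine ⟨N.G r - N.C.comp ((resOne N.A N.β r).comp B₀), fun s hs u => ?_⟩
    have h := N.transfer s r hs hr u
    have e : XOne.mk N.A N.β (resExt N.A N.β s (N.B u) - resExt N.A N.β r (N.B u))
        (resExt_sub_mem N.A N.β s r (N.B u)) =
        resOne N.A N.β s (B₀ u) - resOne N.A N.β r (B₀ u) := by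
      refine Subtype.ext ?_
      change resExt N.A N.β s (N.B u) - resExt N.A N.β r (N.B u) =
        res N.A s (B₀ u) - res N.A r (B₀ u)
      rw [hB, ι, resExt_emb, resExt_emb]
    rw [e, map_sub] at h
    rw [eq_add_of_sub_eq h]
    change _ = N.G r u - N.C (resOne N.A N.β r (B₀ u)) + _
    abel
  · exact ⟨0, fun s h => absurd ⟨s, h⟩ hs⟩

/-- The pair chosen in `outputPrimitive` is unique, since `X` embeds injectively into `X₋₁`. -/
theorem outputPrimitive_eq (s : resolventSet N.A) {u : ℝ → U} {x : ℝ → XMinus N.A N.β} {t : ℝ}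
    (p : (N.combined s).domain) (h1 : N.ι p.1.1 = ∫ r in (0 : ℝ)..t, (t - r) • x r)
    (h2 : p.1.2 = ∫ r in (0 : ℝ)..t, (t - r) • u r) :
    N.outputPrimitive s u x t = N.combined s p := by
  have h : ∃ p : (N.combined s).domain,
      N.ι p.1.1 = ∫ r in (0 : ℝ)..t, (t - r) • x r ∧
      p.1.2 = ∫ r in (0 : ℝ)..t, (t - r) • u r := ⟨p, h1, h2⟩
  rw [outputPrimitive, dif_pos h]
  congr 1
  refine Subtype.ext (Prod.ext ?_ ?_)
  · exact emb_injective N.A N.β (h.choose_spec.1.trans h1.symm)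
  · exact h.choose_spec.2.trans h2.symm

/-- The value of `C&D` at `(R(β, A) q, v)`, for a bounded input operator. -/
theorem exists_combined_res {B₀ : U →L[ℂ] X} (hB : ∀ u, N.B u = N.ι (B₀ u)) {D : U →L[ℂ] Y}
    {s : resolventSet N.A} (hD : ∀ u, N.G s u = D u + N.C (resOne N.A N.β s (B₀ u)))
    (q : X) (v : U) : ∃ p : (N.combined s).domain, p.1 = (res N.A N.β q, v) ∧
      N.combined s p = N.observation q + D v := by
  have hmem : (res N.A N.β q, v) ∈ N.combinedDomain := by
    -- This is `A R(β, A) q + B₀ v`.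
    refine ⟨(N.β : ℂ) • res N.A N.β q - q + B₀ v, ?_⟩
    simp only [hB, map_add, add_sub_cancel_right]
    exact emb_resolvent_mem_extGraph N.A N.β N.β q
  refine ⟨⟨_, hmem⟩, rfl, ?_⟩
  change N.C (XOne.mk N.A N.β (res N.A N.β q - resExt N.A N.β s (N.B v)) _) + N.G s v = _
  have e : XOne.mk N.A N.β (res N.A N.β q - resExt N.A N.β s (N.B v))
      (N.combined_mem s ⟨_, hmem⟩) = resOne N.A N.β N.β q - resOne N.A N.β s (B₀ v) := by
    refine Subtype.ext ?_
    change res N.A N.β q - resExt N.A N.β s (N.B v) = res N.A N.β q - res N.A s (B₀ v)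
    rw [hB, ι, resExt_emb]
  -- The term `C R(s, A) B₀ v` cancels against the same term in `G(s) v`, so the value no longer
  -- depends on `s`.
  rw [e, map_sub, hD]
  change N.observation q - _ + _ = _
  abel

/-- With a bounded input operator, the state of a generalised solution with initial value zero
is the mild solution in `X`. -/
theorem IsGeneralizedSolution.state_eq {N : SystemNode U X Y} {B₀ : U →L[ℂ] X}
    (hB : ∀ u, N.B u = N.ι (B₀ u)) {u : ℝ → U} {x : ℝ → XMinus N.A N.β}
    {y : Distribution (⊤ : TopologicalSpace.Opens ℝ) Y ⊤} (h : N.IsGeneralizedSolution u x y)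
    (hx : x 0 = 0) {t : ℝ} (ht : 0 ≤ t) :
    x t = N.ι (∫ r in (0 : ℝ)..t, N.S.flow (t - r) (B₀ (u r))) := by
  obtain ⟨x₀, h0⟩ := h.state
  have hx0 : x₀ = 0 := by
    have := h0 0 le_rfl
    rw [hx, intervalIntegral.integral_same, add_zero, Real.toNNReal_zero, N.S.map_zero] at this
    exact emb_injective N.A N.β (this.symm.trans (map_zero _).symm)
  have hi : IntervalIntegrable (fun r => B₀ (u r)) volume 0 t :=
    (intervalIntegrable_iff_integrableOn_Ioc_of_le ht).2
      (B₀.integrable_comp ((h.locallyIntegrable.integrableOn_compact_subset Icc_subset_Ici_self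
        isCompact_Icc).mono_set Ioc_subset_Icc_self))
  rw [h0 t ht, hx0, map_zero, map_zero, zero_add]
  change _ = embCLM N.A N.β _
  rw [← ContinuousLinearMap.intervalIntegral_comp_comm _
    (intervalIntegrable_strong_family_apply (K := fun r => N.S.flow (t - r))
      (fun x => (N.S.continuous_flow x).comp (by fun_prop)) hi)]
  refine intervalIntegral.integral_congr fun r _ => ?_
  rw [hB]
  exact semigroupExt_emb N.A N.β N.isGenerator _ _

end SystemNode

end LinSys

/-! ### The stability theorem -/

theorem mainTheorem8 {U X Y : Type*}
    [NormedAddCommGroup U] [NormedSpace ℂ U] [CompleteSpace U]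
    [NormedAddCommGroup X] [NormedSpace ℂ X] [CompleteSpace X]
    [NormedAddCommGroup Y] [NormedSpace ℂ Y] [CompleteSpace Y]
    (N : LinSys.SystemNode U X Y)
    (h0 : (0 : ℂ) ∈ LinSys.resolventSet N.A)
    (hB : N.HasBoundedInput)
    (hC : N.IsInfTimeL1ObsAdmissible) :
    N.IsL1LILOStable := by
  open LinSys in
  obtain ⟨B₀, hB₀⟩ := hB
  obtain ⟨D, hD⟩ := N.exists_feedthrough hB₀
  obtain ⟨c, hc, hobs⟩ := hC.exists_bound
  -- The summand `1` only keeps the constant positive.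
  refine ⟨c * ‖B₀‖ + ‖D‖ + 1, by positivity, fun u x y hy hx => ?_⟩
  have hu := hy.locallyIntegrable
  obtain ⟨f, hf, hf1, hf2⟩ := exists_output N.isGenerator hc.le hobs (hu.clm_comp B₀)
  obtain ⟨s, hs, hys⟩ := hy.output
  -- The observed double primitive of `(x, u)` is the double primitive of `f + D u`, which
  -- identifies the output.
  have hprim : ∀ t, 0 ≤ t → N.outputPrimitive s u x t =
      ∫ σ in (0 : ℝ)..t, (t - σ) • (f σ + D (u σ)) := by
    intro t ht
    obtain ⟨p, hp, hval⟩ := N.exists_combined_res hB₀ (hD s hs)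
      (∫ r in (0 : ℝ)..t, N.S.shiftedDoubleIntegral N.β (t - r) (B₀ (u r)))
      (∫ r in (0 : ℝ)..t, (t - r) • u r)
    rw [N.outputPrimitive_eq s p ?_ (by rw [hp]), hval, ← hf1 t ht,
      ← ContinuousLinearMap.intervalIntegral_comp_comm _ (intervalIntegrable_sub_smul ht (hu.integrableOn_Ioc_zero t)),
      ← intervalIntegral.integral_add (f := fun σ => (t - σ) • f σ)
        (intervalIntegrable_sub_smul ht (hf.integrableOn_Ioc_zero t))]
    · simp only [ContinuousLinearMap.map_smul_of_tower, smul_add]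
    · simp only [ContinuousLinearMap.map_smul_of_tower]
      exact intervalIntegrable_sub_smul ht ((hu.clm_comp D).integrableOn_Ioc_zero t)
    -- The state component is checked in `X₋₁`: the embedding passes through the integral and meets
    -- the mild solution.
    · rw [hp, ← intervalIntegral_sub_smul_convolution_eq N.isGenerator N.β ht ((hu.clm_comp B₀).integrableOn_Ioc_zero t)]
      change embCLM N.A N.β _ = _
      rw [← ContinuousLinearMap.intervalIntegral_comp_comm _
        (intervalIntegrable_sub_smul ht (integrableOn_convolution N.S.continuous_flow ((hu.clm_comp B₀).integrableOn_Ioc_zero t)))]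
      refine intervalIntegral.integral_congr fun r hr => ?_
      rw [uIcc_of_le ht] at hr
      rw [hy.state_eq hB₀ hx hr.1, ContinuousLinearMap.map_smul_of_tower]
      rfl
  have hfD : LocallyIntegrableOn (fun σ => f σ + D (u σ)) (Ici 0) := hf.add (hu.clm_comp D)
  refine ⟨fun σ => f σ + D (u σ), ⟨hfD, fun φ => ?_⟩, fun t ht => ?_⟩
  · rw [hys φ]
    exact integral_iteratedDeriv_two_smul (contDiff_infty.1 φ.contDiff 2) φ.hasCompactSupport hfD hprim
  · have hm : ∀ {g : ℝ → Y}, LocallyIntegrableOn g (Ici 0) →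
        AEStronglyMeasurable g (volume.restrict (Icc 0 t)) :=
      fun hg => (hg.integrableOn_compact_subset Icc_subset_Ici_self
        isCompact_Icc).aestronglyMeasurable
    calc eLpNorm (fun σ => f σ + D (u σ)) 1 (volume.restrict (Icc 0 t))
        ≤ eLpNorm f 1 (volume.restrict (Icc 0 t)) +
            eLpNorm (fun σ => D (u σ)) 1 (volume.restrict (Icc 0 t)) :=
          eLpNorm_add_le (hm hf) (hm (hu.clm_comp D)) le_rfl
      _ ≤ ENNReal.ofReal c * (ENNReal.ofReal ‖B₀‖ * eLpNorm u 1 (volume.restrict (Icc 0 t))) +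
            ENNReal.ofReal ‖D‖ * eLpNorm u 1 (volume.restrict (Icc 0 t)) := by
          gcongr
          · exact (hf2 t).trans (by gcongr; exact eLpNorm_clm_comp_le B₀)
          · exact eLpNorm_clm_comp_le D
      _ = ENNReal.ofReal (c * ‖B₀‖ + ‖D‖) * eLpNorm u 1 (volume.restrict (Icc 0 t)) := by
          rw [ENNReal.ofReal_add (by positivity) (by positivity), ENNReal.ofReal_mul hc.le]
          ring
      _ ≤ _ := by
          gcongr ENNReal.ofReal ?_ * _
          linarith
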